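/- All vector spaces are real. A cone in a vector space is a non-empty subset closed under addition and under multiplication by scalars $\lambda\ge 0$; a pre-ordered normed space $X$ is a normed space with a cone $X_+$, whose elements are called positive, and $B(X)$ denotes the bounded linear operators on $X$. Let $G$ be a locally compact Hausdorff group with identity $e$ and left Haar measure $dr$. Let $A$ be a (not necessarily unital) Banach algebra with a closed cone $A_+$ such that $A_+A_+\subseteq A_+$, and let $\alpha$ be a representation of $G$ on $A$ by bounded algebra automorphisms with $\alpha_s^{\pm1}(A_+)\subseteq A_+$ for all $s$, such that $s\mapsto\alpha_s(a)$ is continuous for every $a\in A$ and $\sup_s\|\alpha_s\|<\infty$. Let $\omega:G\to[0,\infty)$ be a weight, i.e. a non-zero Borel measurable function with $\omega(st)\le\omega(s)\omega(t)$. Let $L^1(G,A,\omega;\alpha)$ be the completion of $C_c(G,A)$ for $\|f\|_{1,\omega}=\int_G\|f(s)\|\omega(s)\,ds$, with the continuous multiplication extending $(f*g)(s)=\int_G f(r)\alpha_r(g(r^{-1}s))\,dr$ and with cone the closure of $C_c(G,A_+)$. Assume that $A$ has a bounded approximate right identity and a bounded approximate left identity contained in $A_+$. Let $X$ be a Banach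 space with a closed cone $X_+$. Consider (a) pairs $(\pi,U)$, where $\pi:A\to B(X)$ is a bounded algebra homomorphism with $\pi(a)X_+\subseteq X_+$ for $a\in A_+$ and $\operatorname{span}\pi(A)X$ dense in $X$, and $U$ is a strongly continuous representation of $G$ on $X$ by invertible bounded operators with $U_s^{\pm1}X_+\subseteq X_+$, such that $\pi(\alpha_s(a))=U_s\pi(a)U_s^{-1}$ for all $a\in A$, $s\in G$, and such that there is $C_U\ge0$ with $\|U_r\|\le C_U\,\omega(r)$ for all $r\in G$; (b) bounded algebra homomorphisms $T:L^1(G,A,\omega;\alpha)\to B(X)$ such that $T(f)X_+\subseteq X_+$ for all positive $f$ and such that $\operatorname{span}\{T(f)x\}$ is dense in $X$. Then the following maps are well defined and mutually inverse bijections between the pairs in (a) and the homomorphisms in (b). The first is $(\pi,U)\mapsto T^{(\pi,U)}$, determined by $$T^{(\pi,U)}(f)x=\int_G\pi(f(r))U_rx\,dr\qquad(f\in C_c(G,A),\ x\in X).$$ The second is $T\mapsto(\pi^T,U^T)$, where $$\pi^T(a)=\operatorname{SOT-lim}_{(V,i)}T(z_V\otimes au_i),\qquad U^T_s=\operatorname{SOT-lim}_{(V,i)}T(z_V(s^{-1}\,\cdot)\otimes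 u_i)\qquad(a\in A,\ s\in G).$$ Here $\mathcal Z$ is any neighbourhood base of $e$ all of whose elements are contained in a fixed compact set; for each $V\in\mathcal Z$, $z_V\in C_c(G)$ is any non-negative function that vanishes outside $V$ and has integral $1$; $(u_i)$ is any bounded approximate left identity of $A$ contained in $A_+$; $(z\otimes a)(r)=z(r)a$; and $(V,i)\le(W,j)$ means $W\subseteq V$ and $i\le j$. The limits exist, and $(\pi^T,U^T)$ does not depend on these choices. Furthermore, if $A$ has an $M$-bounded (not necessarily positive) approximate left identity, then for all $(\pi,U)$ as in (a) and every $C_U$ as above, all $T$ as in (b), and every $\mathcal Z$ as above: 1. $\|T^{(\pi,U)}\|\le C_U\|\pi\|$; 2. $\|\pi^T\|\le\bigl(\inf_{V\in\mathcal Z}\sup_{r\in V}\omega(r)\bigr)\|T\|$; 3. $\|U^T_s\|\le M\bigl(\inf_{V\in\mathcal Z}\sup_{r\in V}\omega(r)\bigr)\|T\|\,\omega(s)$ for all $s\in G$. -/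

import Mathlib

open MeasureTheory Filter Topology Set
open scoped CompactlySupported Pointwise

noncomputable section

/-! ### Weights -/

/-- A weight on `G`: a non-zero submultiplicative Borel measurable function `G → [0, ∞)`. -/
structure GroupWeight (G : Type*) [Group G] [MeasurableSpace G] where
  toFun : G → ℝ
  nonneg' : ∀ s, 0 ≤ toFun s
  measurable' : Measurable toFun
  submul' : ∀ s t, toFun (s * t) ≤ toFun s * toFun t
  ne_zero' : ∃ s, toFun s ≠ 0

namespace GroupWeight

variable {G : Type*} [Group G] [MeasurableSpace G]

instance : CoeFun (GroupWeight G) (fun _ => G → ℝ) := ⟨GroupWeight.toFun⟩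

variable (ω : GroupWeight G)

lemma pos (s : G) : 0 < ω s := by
  refine lt_of_le_of_ne (ω.nonneg' s) fun h => ?_
  obtain ⟨t, ht⟩ := ω.ne_zero'
  have := ω.submul' s (s⁻¹ * t)
  rw [mul_inv_cancel_left, ← h, zero_mul] at this
  exact ht (le_antisymm this (ω.nonneg' t))

/-- The measure `ω dμ`. -/
def weightedMeasure (μ : Measure G) : Measure G :=
  μ.withDensity fun s => ((ω s).toNNReal : ENNReal)

lemma integral_weightedMeasure (μ : Measure G) (g : G → ℝ) :
    ∫ s, g s ∂(ω.weightedMeasure μ) = ∫ s, g s * ω s ∂μ := by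
  rw [weightedMeasure, integral_withDensity_eq_integral_smul ω.measurable'.real_toNNReal]
  refine integral_congr_ae (Eventually.of_forall fun s => ?_)
  simp [NNReal.smul_def, ω.nonneg' s, mul_comm]

lemma integrable_weightedMeasure_iff (μ : Measure G) (g : G → ℝ) :
    Integrable g (ω.weightedMeasure μ) ↔ Integrable (fun s => g s * ω s) μ := by
  rw [weightedMeasure, integrable_withDensity_iff_integrable_smul ω.measurable'.real_toNNReal]
  refine integrable_congr (Eventually.of_forall fun s => ?_)
  simp [NNReal.smul_def, ω.nonneg' s, mul_comm]

variable [TopologicalSpace G] [IsTopologicalGroup G] [LocallyCompactSpace G] [BorelSpace G]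

/-- A weight is locally bounded. -/
lemma locally_bounded (s : G) : ∃ M : ℝ, ∀ᶠ t in 𝓝 s, ω t ≤ M := by
  let μ : Measure G := Measure.haar
  let E : ℕ → Set G := fun n => {x | ω x ≤ n} ∩ {x | ω x⁻¹ ≤ n}
  have hE : ∀ n, MeasurableSet (E n) := fun n =>
    (measurableSet_le ω.measurable' measurable_const).inter
      (measurableSet_le (ω.measurable'.comp measurable_inv) measurable_const)
  obtain ⟨K, hK, hK1⟩ := exists_compact_mem_nhds (1 : G)
  have hU : (⋃ n, E n) = univ := by
    refine eq_univ_of_forall fun x => ?_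
    obtain ⟨n, hn⟩ := exists_nat_ge (max (ω x) (ω x⁻¹))
    exact mem_iUnion.2 ⟨n, (le_max_left _ _).trans hn, (le_max_right _ _).trans hn⟩
  obtain ⟨L, hL, hLc, hKL⟩ : ∃ L, L ∈ 𝓝 (1 : G) ∧ IsClosed L ∧ IsCompact L :=
    ⟨closure K, mem_of_superset hK1 subset_closure, isClosed_closure, hK.closure⟩
  have hpos : 0 < μ L := Measure.measure_pos_of_mem_nhds μ hL
  have : ∃ n, 0 < μ (E n ∩ L) := by
    by_contra! hcon
    have h0 : μ (⋃ n, E n ∩ L) = 0 := measure_iUnion_null fun n => le_antisymm (hcon n) bot_le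
    rw [← iUnion_inter, hU, univ_inter] at h0
    exact hpos.ne' h0
  obtain ⟨n, hn⟩ := this
  have hfin : μ (E n ∩ L) ≠ ⊤ :=
    ((measure_mono inter_subset_right).trans_lt hKL.measure_lt_top).ne
  have hN : (E n ∩ L) / (E n ∩ L) ∈ 𝓝 (1 : G) :=
    Measure.div_mem_nhds_one_of_haar_pos_ne_top μ _ ((hE n).inter hLc.measurableSet) hn hfin
  refine ⟨ω s * (n * n), ?_⟩
  have ht : Tendsto (fun t => s⁻¹ * t) (𝓝 s) (𝓝 1) := by
    have : Continuous fun t : G => s⁻¹ * t := by fun_prop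
    simpa using this.tendsto s
  filter_upwards [ht hN] with t hmem
  obtain ⟨x, ⟨hx, -⟩, y, ⟨hy, -⟩, hxy⟩ := hmem
  have h1 : ω t ≤ ω s * ω (s⁻¹ * t) := by
    simpa using ω.submul' s (s⁻¹ * t)
  have h2 : ω (s⁻¹ * t) ≤ n * n := by
    rw [show s⁻¹ * t = x * y⁻¹ by rw [← div_eq_mul_inv]; exact hxy.symm]
    exact (ω.submul' _ _).trans (mul_le_mul hx.1 hy.2 (ω.nonneg' _) (Nat.cast_nonneg n))
  exact h1.trans (mul_le_mul_of_nonneg_left h2 (ω.nonneg' s))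

/-- A weight is bounded on compact sets. -/
lemma bounded_on_compact {K : Set G} (hK : IsCompact K) : ∃ M : ℝ, 0 ≤ M ∧ ∀ t ∈ K, ω t ≤ M := by
  refine hK.induction_on (p := fun K => ∃ M : ℝ, 0 ≤ M ∧ ∀ t ∈ K, ω t ≤ M)
    ⟨0, le_rfl, by simp⟩ ?_ ?_ ?_
  · rintro s t hst ⟨M, h0, hM⟩
    exact ⟨M, h0, fun x hx => hM x (hst hx)⟩
  · rintro s t ⟨M, h0, hM⟩ ⟨N, -, hN⟩
    exact ⟨max M N, h0.trans (le_max_left _ _), fun x hx => hx.elim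
      (fun h => (hM x h).trans (le_max_left _ _)) (fun h => (hN x h).trans (le_max_right _ _))⟩
  · intro s _
    obtain ⟨M, hM⟩ := ω.locally_bounded s
    exact ⟨{t | ω t ≤ M}, mem_nhdsWithin_of_mem_nhds hM, M, (ω.nonneg' s).trans hM.self_of_nhds,
      fun t ht => ht⟩

instance (μ : Measure G) [IsFiniteMeasureOnCompacts μ] :
    IsFiniteMeasureOnCompacts (ω.weightedMeasure μ) where
  lt_top_of_isCompact K hK := by
    obtain ⟨M, -, hM⟩ := ω.bounded_on_compact hK.closure
    refine (measure_mono subset_closure).trans_lt ?_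
    rw [weightedMeasure, withDensity_apply _ isClosed_closure.measurableSet]
    refine (setLIntegral_mono' isClosed_closure.measurableSet (g := fun _ => (M.toNNReal : ENNReal))
      fun x hx => ?_).trans_lt ?_
    · exact_mod_cast Real.toNNReal_le_toNNReal (hM x hx)
    · rw [setLIntegral_const]
      exact ENNReal.mul_lt_top ENNReal.coe_lt_top hK.closure.measure_lt_top

lemma integrable_norm_mul (μ : Measure G) [IsFiniteMeasureOnCompacts μ] {X : Type*}
    [NormedAddCommGroup X] (h : C_c(G, X)) : Integrable (fun s => ‖h s‖ * ω s) μ :=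
  (ω.integrable_weightedMeasure_iff μ _).1 (h.integrable (μ := ω.weightedMeasure μ)).norm

end GroupWeight

/-! ### The weighted space `L¹(G, X, ω)` -/

section WeightedL1

variable {G : Type*} [Group G] [TopologicalSpace G] [MeasurableSpace G]

/-- The space `C_c(G, X)`, to be normed by `‖h‖ = ∫ ‖h(s)‖ ω(s) dμ(s)`. -/
def WeightedCc (_μ : Measure G) (_ω : GroupWeight G) (X : Type*) [NormedAddCommGroup X] : Type _ :=
  C_c(G, X)

namespace WeightedCc

variable {μ : Measure G} {ω : GroupWeight G} {X : Type*} [NormedAddCommGroup X]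

instance : AddCommGroup (WeightedCc μ ω X) := inferInstanceAs (AddCommGroup C_c(G, X))
instance : FunLike (WeightedCc μ ω X) G X := inferInstanceAs (FunLike C_c(G, X) G X)
instance [NormedSpace ℝ X] : Module ℝ (WeightedCc μ ω X) := inferInstanceAs (Module ℝ C_c(G, X))

/-- A compactly supported continuous function as an element of the weighted space. -/
def of (μ : Measure G) (ω : GroupWeight G) (h : C_c(G, X)) : WeightedCc μ ω X := h

/-- The compactly supported continuous function underlying an element of the weighted space. -/
def fn (h : WeightedCc μ ω X) : C_c(G, X) := h

variable [IsTopologicalGroup G] [LocallyCompactSpace G] [BorelSpace G] [μ.IsHaarMeasure]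

instance : NormedAddCommGroup (WeightedCc μ ω X) :=
  AddGroupNorm.toNormedAddCommGroup
    { toFun := fun h => ∫ s, ‖h s‖ * ω s ∂μ
      map_zero' := by
        have : ∀ s, (0 : WeightedCc μ ω X) s = 0 := fun s => rfl
        simp [this]
      neg' := fun h => by
        have : ∀ s, (-h) s = -(h s) := fun s => rfl
        simp [this]
      add_le' := fun f g => by
        refine le_of_le_of_eq ?_ (integral_add (ω.integrable_norm_mul μ f.fn)
          (ω.integrable_norm_mul μ g.fn))
        refine integral_mono (ω.integrable_norm_mul μ (f + g).fn)
          ((ω.integrable_norm_mul μ f.fn).add (ω.integrable_norm_mul μ g.fn)) fun s => ?_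
        have h1 : ‖(f + g) s‖ ≤ ‖f s‖ + ‖g s‖ := norm_add_le (f s) (g s)
        have h2 := mul_le_mul_of_nonneg_right h1 (ω.nonneg' s)
        rw [add_mul] at h2
        exact h2
      eq_zero_of_map_eq_zero' := fun h hh => by
        have h1 := (integral_eq_zero_iff_of_nonneg
          (fun s => mul_nonneg (norm_nonneg _) (ω.nonneg' s))
          (ω.integrable_norm_mul μ h.fn)).1 hh
        have h2 : (h.fn : G → X) =ᵐ[μ] fun _ => 0 := by
          filter_upwards [h1] with s hs
          exact norm_eq_zero.1 ((mul_eq_zero.1 hs).resolve_right (ω.pos s).ne')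
        have h3 := Measure.eq_of_ae_eq h2 h.fn.continuous continuous_const
        exact DFunLike.ext _ _ fun s => congrFun h3 s }

lemma norm_def (h : WeightedCc μ ω X) : ‖h‖ = ∫ s, ‖h s‖ * ω s ∂μ := rfl

instance [NormedSpace ℝ X] : NormedSpace ℝ (WeightedCc μ ω X) where
  norm_smul_le c h := by
    have : ∀ s, (c • h) s = c • h s := fun s => rfl
    simp only [norm_def, this, norm_smul, mul_assoc, integral_const_mul, le_refl]

end WeightedCc

variable [IsTopologicalGroup G] [LocallyCompactSpace G] [BorelSpace G]

/-- The Banach space `L¹(G, X, ω)`: the completion of `C_c(G, X)` in the weighted `1`-norm. -/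
abbrev WeightedL1 (μ : Measure G) [μ.IsHaarMeasure] (ω : GroupWeight G) (X : Type*)
    [NormedAddCommGroup X] : Type _ :=
  UniformSpace.Completion (WeightedCc μ ω X)

/-- The canonical map `C_c(G, X) → L¹(G, X, ω)`. -/
def toWeightedL1 (μ : Measure G) [μ.IsHaarMeasure] (ω : GroupWeight G) {X : Type*}
    [NormedAddCommGroup X] (h : C_c(G, X)) : WeightedL1 μ ω X :=
  ((WeightedCc.of μ ω h : WeightedCc μ ω X) : UniformSpace.Completion (WeightedCc μ ω X))

/-- The cone of `L¹(G, X, ω)`: the closure of `C_c(G, X₊)`. -/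
def weightedL1Cone (μ : Measure G) [μ.IsHaarMeasure] (ω : GroupWeight G) {X : Type*}
    [NormedAddCommGroup X] [NormedSpace ℝ X] (C : PointedCone ℝ X) : Set (WeightedL1 μ ω X) :=
  closure (toWeightedL1 μ ω '' {h : C_c(G, X) | ∀ s, h s ∈ C})

end WeightedL1

/-! ### Pre-ordered Banach algebra dynamical systems -/

/-- A pre-ordered Banach algebra dynamical system `(A, G, α)`, where the (not necessarily unital)
Banach algebra `A` is pre-ordered by a closed cone which is closed under multiplication, and `α` is
a strongly continuous representation of `G` on `A` by bounded bipositive algebra automorphisms. -/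
structure PreorderedDynamicalSystem (G A : Type*) [Group G] [TopologicalSpace G]
    [NonUnitalNormedRing A] [NormedSpace ℝ A] where
  cone : PointedCone ℝ A
  isClosed_cone : IsClosed (cone : Set A)
  mul_mem_cone : ∀ a ∈ cone, ∀ b ∈ cone, a * b ∈ cone
  α : G →* (A ≃L[ℝ] A)
  α_mul : ∀ s a b, α s (a * b) = α s a * α s b
  α_bipositive : ∀ s a, α s a ∈ cone ↔ a ∈ cone
  continuous_α : ∀ a, Continuous fun s => α s a

namespace PreorderedDynamicalSystem

variable {G A : Type*} [Group G] [TopologicalSpace G] [NonUnitalNormedRing A] [NormedSpace ℝ A]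
  (D : PreorderedDynamicalSystem G A)

/-- `α` is uniformly bounded. -/
def UniformlyBounded : Prop := ∃ C : ℝ, ∀ s, ‖(D.α s : A →L[ℝ] A)‖ ≤ C

lemma continuous_uncurry_α {D : PreorderedDynamicalSystem G A} (hα : D.UniformlyBounded) :
    Continuous fun p : G × A => D.α p.1 p.2 := by
  obtain ⟨C, hC⟩ := hα
  rw [continuous_iff_continuousAt]
  rintro ⟨r₀, a₀⟩
  rw [ContinuousAt, tendsto_iff_norm_sub_tendsto_zero]
  have h1 : Tendsto (fun p : G × A => C * ‖p.2 - a₀‖ + ‖D.α p.1 a₀ - D.α r₀ a₀‖)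
      (𝓝 (r₀, a₀)) (𝓝 0) := by
    have hc : Continuous fun p : G × A => C * ‖p.2 - a₀‖ + ‖D.α p.1 a₀ - D.α r₀ a₀‖ := by
      have := (D.continuous_α a₀).comp (continuous_fst : Continuous (Prod.fst : G × A → G))
      simp only [Function.comp_def] at this
      fun_prop
    simpa using hc.tendsto (r₀, a₀)
  refine squeeze_zero (fun _ => norm_nonneg _) (fun p => ?_) h1
  calc ‖D.α p.1 p.2 - D.α r₀ a₀‖ = ‖D.α p.1 (p.2 - a₀) + (D.α p.1 a₀ - D.α r₀ a₀)‖ := by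
        rw [map_sub]; congr 1; abel
    _ ≤ ‖D.α p.1 (p.2 - a₀)‖ + ‖D.α p.1 a₀ - D.α r₀ a₀‖ := norm_add_le _ _
    _ ≤ C * ‖p.2 - a₀‖ + ‖D.α p.1 a₀ - D.α r₀ a₀‖ := by
        gcongr
        exact (D.α p.1 : A →L[ℝ] A).le_of_opNorm_le (hC p.1) _

variable {D} [IsTopologicalGroup G]

lemma continuous_convIntegrand (hα : D.UniformlyBounded) (f g : C_c(G, A)) :
    Continuous fun p : G × G => f p.2 * D.α p.2 (g (p.2⁻¹ * p.1)) := by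
  have h1 : Continuous fun p : G × G => D.α p.2 (g (p.2⁻¹ * p.1)) :=
    (continuous_uncurry_α hα).comp (f := fun p : G × G => (p.2, g (p.2⁻¹ * p.1)))
      (continuous_snd.prodMk (g.continuous.comp (by fun_prop)))
  exact (f.continuous.comp continuous_snd).mul h1

variable [MeasurableSpace G] [BorelSpace G]

lemma integrable_convIntegrand (hα : D.UniformlyBounded) (μ : Measure G)
    [IsFiniteMeasureOnCompacts μ] (f g : C_c(G, A)) (s : G) :
    Integrable (fun r => f r * D.α r (g (r⁻¹ * s))) μ := by
  have hc : Continuous fun r => f r * D.α r (g (r⁻¹ * s)) :=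
    (continuous_convIntegrand hα f g).comp (by fun_prop : Continuous fun r : G => (s, r))
  exact hc.integrable_of_hasCompactSupport f.hasCompactSupport.mul_right

/-- The twisted convolution `(f * g)(s) = ∫ f(r) α_r(g(r⁻¹ s)) dμ(r)` on `C_c(G, A)`. -/
def twistedConv (hα : D.UniformlyBounded) (μ : Measure G) [IsFiniteMeasureOnCompacts μ]
    [T2Space G] (f g : C_c(G, A)) : C_c(G, A) where
  toFun s := ∫ r, f r * D.α r (g (r⁻¹ * s)) ∂μ
  continuous_toFun := by
    rw [← continuousOn_univ]
    refine continuousOn_integral_of_compact_support (k := tsupport f) f.hasCompactSupport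
      (f := fun s r => f r * D.α r (g (r⁻¹ * s))) ?_ ?_
    · exact (continuous_convIntegrand hα f g).continuousOn
    · intro s r _ hr
      simp [image_eq_zero_of_notMem_tsupport hr]
  hasCompactSupport' := by
    refine HasCompactSupport.intro (K := tsupport f * tsupport g)
      (IsCompact.mul f.hasCompactSupport g.hasCompactSupport) fun s hs => ?_
    have : ∀ r, f r * D.α r (g (r⁻¹ * s)) = 0 := by
      intro r
      by_cases hr : r ∈ tsupport f
      · have : r⁻¹ * s ∉ tsupport g := fun h =>
          hs ⟨r, hr, r⁻¹ * s, h, mul_inv_cancel_left r s⟩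
        simp [image_eq_zero_of_notMem_tsupport this]
      · simp [image_eq_zero_of_notMem_tsupport hr]
    simp [this]

variable [T2Space G] [LocallyCompactSpace G]

/-- With `‖α_s‖ ≤ C` for all `s`, one has `‖f * g‖ ≤ C ‖f‖ ‖g‖` for the weighted `1`-norm. -/
lemma norm_twistedConv_le (hα : D.UniformlyBounded) (μ : Measure G) [μ.IsHaarMeasure]
    (ω : GroupWeight G) {C : ℝ} (hC : ∀ s, ‖(D.α s : A →L[ℝ] A)‖ ≤ C) (f g : C_c(G, A)) :
    ‖WeightedCc.of μ ω (twistedConv hα μ f g)‖ ≤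
      C * ‖WeightedCc.of μ ω f‖ * ‖WeightedCc.of μ ω g‖ := by
  have hC0 : 0 ≤ C := (norm_nonneg _).trans (hC 1)
  let F : G → G → ℝ := fun s r => ‖f r‖ * ‖g (r⁻¹ * s)‖
  have hFc : Continuous F.uncurry := by
    have h1 : Continuous fun p : G × G => g (p.2⁻¹ * p.1) := g.continuous.comp (by fun_prop)
    have h2 : Continuous fun p : G × G => f p.2 := f.continuous.comp continuous_snd
    exact h2.norm.mul h1.norm
  have hFs : HasCompactSupport F.uncurry := by
    refine HasCompactSupport.intro (K := (tsupport f * tsupport g) ×ˢ tsupport f)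
      ((IsCompact.mul f.hasCompactSupport g.hasCompactSupport).prod f.hasCompactSupport) ?_
    rintro ⟨s, r⟩ hsr
    by_cases hr : r ∈ tsupport f
    · have : r⁻¹ * s ∉ tsupport g := fun h =>
        hsr ⟨⟨r, hr, r⁻¹ * s, h, mul_inv_cancel_left r s⟩, hr⟩
      simp [F, Function.uncurry, image_eq_zero_of_notMem_tsupport this]
    · simp [F, Function.uncurry, image_eq_zero_of_notMem_tsupport hr]
  let ν := ω.weightedMeasure μ
  have hpt : ∀ s, ‖twistedConv hα μ f g s‖ ≤ C * ∫ r, F s r ∂μ := by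
    intro s
    have hFi : Integrable (F s) μ := by
      have hc : Continuous (F s) := hFc.comp (by fun_prop : Continuous fun r : G => (s, r))
      exact hc.integrable_of_hasCompactSupport f.hasCompactSupport.norm.mul_right
    rw [← integral_const_mul]
    refine (norm_integral_le_integral_norm _).trans (integral_mono
      (integrable_convIntegrand hα μ f g s).norm (hFi.const_mul C) fun r => ?_)
    calc ‖f r * D.α r (g (r⁻¹ * s))‖ ≤ ‖f r‖ * ‖D.α r (g (r⁻¹ * s))‖ := norm_mul_le _ _
      _ ≤ ‖f r‖ * (C * ‖g (r⁻¹ * s)‖) := by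
          gcongr
          exact (D.α r : A →L[ℝ] A).le_of_opNorm_le (hC r) _
      _ = C * F s r := by simp only [F]; ring
  have hGc : Continuous fun s => ∫ r, F s r ∂μ := by
    rw [← continuousOn_univ]
    refine continuousOn_integral_of_compact_support (k := tsupport f) f.hasCompactSupport
      hFc.continuousOn ?_
    intro s r _ hr
    simp [F, image_eq_zero_of_notMem_tsupport hr]
  have hGs : HasCompactSupport fun s => ∫ r, F s r ∂μ := by
    refine HasCompactSupport.intro (K := tsupport f * tsupport g)
      (IsCompact.mul f.hasCompactSupport g.hasCompactSupport) fun s hs => ?_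
    have : ∀ r, F s r = 0 := by
      intro r
      by_cases hr : r ∈ tsupport f
      · have : r⁻¹ * s ∉ tsupport g := fun h =>
          hs ⟨r, hr, r⁻¹ * s, h, mul_inv_cancel_left r s⟩
        simp [F, image_eq_zero_of_notMem_tsupport this]
      · simp [F, image_eq_zero_of_notMem_tsupport hr]
    simp [this]
  have hin : ∀ r, ∫ s, F s r ∂ν ≤ ‖f r‖ * ω r * ‖WeightedCc.of μ ω g‖ := by
    intro r
    have hg1 := ω.integrable_norm_mul μ g
    have hsh : ∫ s, ‖g (r⁻¹ * s)‖ * ω s ∂μ = ∫ t, ‖g t‖ * ω (r * t) ∂μ := by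
      rw [← integral_mul_left_eq_self (fun s => ‖g (r⁻¹ * s)‖ * ω s) r]
      simp
    have hle : ∫ t, ‖g t‖ * ω (r * t) ∂μ ≤ ∫ t, ω r * (‖g t‖ * ω t) ∂μ := by
      refine integral_mono_of_nonneg
        (Eventually.of_forall fun t => mul_nonneg (norm_nonneg _) (ω.nonneg' _))
        (hg1.const_mul _) (Eventually.of_forall fun t => ?_)
      calc ‖g t‖ * ω (r * t) ≤ ‖g t‖ * (ω r * ω t) :=
            mul_le_mul_of_nonneg_left (ω.submul' r t) (norm_nonneg _)
        _ = ω r * (‖g t‖ * ω t) := by ring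
    rw [integral_const_mul] at hle
    simp only [F]
    rw [integral_const_mul, ω.integral_weightedMeasure, hsh, mul_assoc]
    exact mul_le_mul_of_nonneg_left hle (norm_nonneg _)
  calc ‖WeightedCc.of μ ω (twistedConv hα μ f g)‖
      = ∫ s, ‖twistedConv hα μ f g s‖ ∂ν := (ω.integral_weightedMeasure μ _).symm
    _ ≤ ∫ s, C * ∫ r, F s r ∂μ ∂ν :=
        integral_mono (CompactlySupportedContinuousMap.integrable _).norm
          ((hGc.integrable_of_hasCompactSupport hGs).const_mul C) hpt
    _ = C * ∫ s, ∫ r, F s r ∂μ ∂ν := integral_const_mul _ _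
    _ = C * ∫ r, ∫ s, F s r ∂ν ∂μ := by
        rw [integral_integral_swap_of_hasCompactSupport hFc hFs]
    _ ≤ C * ∫ r, ‖f r‖ * ω r * ‖WeightedCc.of μ ω g‖ ∂μ := by
        refine mul_le_mul_of_nonneg_left (integral_mono_of_nonneg
          (Eventually.of_forall fun r => integral_nonneg fun s => by positivity)
          ((ω.integrable_norm_mul μ f).mul_const _) (Eventually.of_forall hin)) hC0
    _ = C * ‖WeightedCc.of μ ω f‖ * ‖WeightedCc.of μ ω g‖ := by
        rw [integral_mul_const, mul_assoc]; rfl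

variable [IsScalarTower ℝ A A] [SMulCommClass ℝ A A]

/-- Twisted convolution as a bounded bilinear map for the weighted `1`-norm. -/
def convCc (hα : D.UniformlyBounded) (μ : Measure G) [μ.IsHaarMeasure] (ω : GroupWeight G) :
    WeightedCc μ ω A →L[ℝ] WeightedCc μ ω A →L[ℝ] WeightedCc μ ω A :=
  LinearMap.mkContinuousOfExistsBound₂
    (LinearMap.mk₂ ℝ (fun f g => WeightedCc.of μ ω (twistedConv hα μ f.fn g.fn))
      (fun f₁ f₂ g => DFunLike.ext _ _ fun s => by
        refine Eq.trans (integral_congr_ae (Eventually.of_forall fun r => ?_))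
          (integral_add (integrable_convIntegrand hα μ f₁.fn g.fn s)
            (integrable_convIntegrand hα μ f₂.fn g.fn s))
        exact add_mul (f₁.fn r) (f₂.fn r) _)
      (fun c f g => DFunLike.ext _ _ fun s => by
        refine Eq.trans (integral_congr_ae (Eventually.of_forall fun r => ?_))
          (integral_smul c fun r => f.fn r * D.α r (g.fn (r⁻¹ * s)))
        exact smul_mul_assoc c (f.fn r) _)
      (fun f g₁ g₂ => DFunLike.ext _ _ fun s => by
        refine Eq.trans (integral_congr_ae (Eventually.of_forall fun r => ?_))
          (integral_add (integrable_convIntegrand hα μ f.fn g₁.fn s)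
            (integrable_convIntegrand hα μ f.fn g₂.fn s))
        have : (g₁ + g₂).fn (r⁻¹ * s) = g₁.fn (r⁻¹ * s) + g₂.fn (r⁻¹ * s) := rfl
        simp only [this, map_add, mul_add])
      (fun c f g => DFunLike.ext _ _ fun s => by
        refine Eq.trans (integral_congr_ae (Eventually.of_forall fun r => ?_))
          (integral_smul c fun r => f.fn r * D.α r (g.fn (r⁻¹ * s)))
        have : (c • g).fn (r⁻¹ * s) = c • g.fn (r⁻¹ * s) := rfl
        simp only [this, map_smul, mul_smul_comm]))
    (by
      obtain ⟨C, hC⟩ := id hα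
      exact ⟨C, fun f g => norm_twistedConv_le hα μ ω hC f.fn g.fn⟩)

/-- The continuous multiplication of the generalized Beurling algebra `L¹(G, A, ω; α)`: the
continuous bilinear extension of the twisted convolution on `C_c(G, A)` to its completion
`L¹(G, A, ω)`. -/
def beurlingMul (hα : D.UniformlyBounded) (μ : Measure G) [μ.IsHaarMeasure] (ω : GroupWeight G) :
    WeightedL1 μ ω A →L[ℝ] WeightedL1 μ ω A →L[ℝ] WeightedL1 μ ω A :=
  let ι : WeightedCc μ ω A →L[ℝ] WeightedL1 μ ω A := UniformSpace.Completion.toComplL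
  (((((ContinuousLinearMap.compL ℝ _ _ _ ι).comp (convCc hα μ ω)).flip.extend ι).flip).extend ι)

/-- On `C_c(G, A)` the multiplication is the twisted convolution. -/
lemma beurlingMul_toWeightedL1 (hα : D.UniformlyBounded) (μ : Measure G) [μ.IsHaarMeasure]
    (ω : GroupWeight G) (f g : C_c(G, A)) :
    beurlingMul hα μ ω (toWeightedL1 μ ω f) (toWeightedL1 μ ω g) =
      toWeightedL1 μ ω (twistedConv hα μ f g) := by
  let ι : WeightedCc μ ω A →L[ℝ] WeightedL1 μ ω A := UniformSpace.Completion.toComplL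
  have hd : DenseRange ι := UniformSpace.Completion.denseRange_coe
  have hu : IsUniformInducing ι := UniformSpace.Completion.isUniformInducing_coe _
  have h1 := ContinuousLinearMap.extend_eq
    ((((ContinuousLinearMap.compL ℝ _ _ _ ι).comp (convCc hα μ ω)).flip.extend ι).flip) hd hu
    (WeightedCc.of μ ω f)
  have h2 := ContinuousLinearMap.extend_eq
    (((ContinuousLinearMap.compL ℝ _ _ _ ι).comp (convCc hα μ ω)).flip) hd hu
    (WeightedCc.of μ ω g)
  exact (congrArg (fun L => L (ι (WeightedCc.of μ ω g))) h1).trans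
    (congrArg (fun L => L (WeightedCc.of μ ω f)) h2)

end PreorderedDynamicalSystem

/-! ### Approximate identities -/

section ApproximateIdentities

universe u

/-- The net `(e i)` is an `M`-bounded approximate left identity: `e i * a → a` for all `a`. -/
structure IsApproxLeftIdentity {A ι : Type*} [NonUnitalNormedRing A] [Preorder ι] (M : ℝ)
    (e : ι → A) : Prop where
  bounded : ∀ i, ‖e i‖ ≤ M
  tendsto : ∀ a, Tendsto (fun i => e i * a) atTop (𝓝 a)

/-- The net `(e i)` is an `M`-bounded approximate right identity: `a * e i → a` for all `a`. -/
structure IsApproxRightIdentity {A ι : Type*} [NonUnitalNormedRing A] [Preorder ι] (M : ℝ)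
    (e : ι → A) : Prop where
  bounded : ∀ i, ‖e i‖ ≤ M
  tendsto : ∀ a, Tendsto (fun i => a * e i) atTop (𝓝 a)

/-- There is an `M`-bounded approximate left identity with values in `S`, indexed by a non-empty
directed set. Taking the index set in the universe of `A` is no restriction: an approximate
identity in `S` with bound `M` can be re-indexed by the pairs of a finite subset of `A` and a
natural number. -/
def HasApproxLeftIdentityIn {A : Type u} [NonUnitalNormedRing A] (M : ℝ) (S : Set A) : Prop :=
  ∃ (ι : Type u) (_ : Preorder ι) (_ : IsDirectedOrder ι) (_ : Nonempty ι) (e : ι → A),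
    IsApproxLeftIdentity M e ∧ ∀ i, e i ∈ S

/-- There is an `M`-bounded approximate right identity, indexed by a non-empty directed set. -/
def HasApproxRightIdentity (A : Type u) [NonUnitalNormedRing A] (M : ℝ) : Prop :=
  ∃ (ι : Type u) (_ : Preorder ι) (_ : IsDirectedOrder ι) (_ : Nonempty ι) (e : ι → A),
    IsApproxRightIdentity M e

end ApproximateIdentities

/-! ### Representations -/

section Representations

variable {G A X : Type*} [Group G] [TopologicalSpace G]
  [NonUnitalNormedRing A] [NormedSpace ℝ A] [NormedAddCommGroup X] [NormedSpace ℝ X]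

/-- The positive non-degenerate continuous covariant representations `(π, U)` of `(A, G, α)` on
`X`, pre-ordered by the cone `Xpos`, such that `‖U_r‖ ≤ C ω(r)` for some `C ≥ 0` and all `r`. -/
@[ext]
structure PositiveCovariantRep [MeasurableSpace G] (D : PreorderedDynamicalSystem G A)
    (ω : GroupWeight G) (Xpos : PointedCone ℝ X) where
  π : A →L[ℝ] X →L[ℝ] X
  U : G →* (X ≃L[ℝ] X)
  π_mul : ∀ a b x, π (a * b) x = π a (π b x)
  covariant : ∀ a s x, π (D.α s a) x = U s (π a ((U s).symm x))
  continuous_U : ∀ x, Continuous fun s => U s x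
  nondegenerate : Dense (Submodule.span ℝ {y : X | ∃ a x, y = π a x} : Set X)
  π_positive : ∀ a ∈ D.cone, ∀ x ∈ Xpos, π a x ∈ Xpos
  U_bipositive : ∀ s x, U s x ∈ Xpos ↔ x ∈ Xpos
  growth : ∃ C : ℝ, 0 ≤ C ∧ ∀ r, ‖(U r : X →L[ℝ] X)‖ ≤ C * ω r

/-- The positive non-degenerate bounded representations of the pre-ordered generalized Beurling
algebra `L¹(G, A, ω; α)` on `X`, pre-ordered by the cone `Xpos`. -/
@[ext]
structure PositiveBeurlingRep [IsTopologicalGroup G] [T2Space G] [LocallyCompactSpace G]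
    [MeasurableSpace G] [BorelSpace G] [IsScalarTower ℝ A A] [SMulCommClass ℝ A A]
    {D : PreorderedDynamicalSystem G A} (hα : D.UniformlyBounded)
    (μ : Measure G) [μ.IsHaarMeasure] (ω : GroupWeight G) (Xpos : PointedCone ℝ X) where
  T : WeightedL1 μ ω A →L[ℝ] X →L[ℝ] X
  map_mul : ∀ f g x, T (PreorderedDynamicalSystem.beurlingMul hα μ ω f g) x = T f (T g x)
  nondegenerate : Dense (Submodule.span ℝ {y : X | ∃ f x, y = T f x} : Set X)
  positive : ∀ f ∈ weightedL1Cone μ ω D.cone, ∀ x ∈ Xpos, T f x ∈ Xpos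

/-- The function `z ⊗ a : r ↦ z(r) a`. -/
def ccTensor (z : C_c(G, ℝ)) (a : A) : C_c(G, A) where
  toFun r := z r • a
  continuous_toFun := z.continuous.smul continuous_const
  hasCompactSupport' := z.hasCompactSupport.smul_right

/-- The left translate `z(s⁻¹ ·)`. -/
def ccTranslate [IsTopologicalGroup G] (s : G) (z : C_c(G, ℝ)) : C_c(G, ℝ) where
  toFun r := z (s⁻¹ * r)
  continuous_toFun := z.continuous.comp (continuous_const_mul s⁻¹)
  hasCompactSupport' := z.hasCompactSupport.comp_homeomorph (Homeomorph.mulLeft s⁻¹)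

/-- `𝒵` is a neighbourhood base of the identity element, all elements of which are contained in a
fixed compact subset of `G`. -/
structure IsCompactlyBoundedNhdsBase (𝒵 : Set (Set G)) : Prop where
  hasBasis : (𝓝 (1 : G)).HasBasis (fun V => V ∈ 𝒵) id
  exists_compact : ∃ K : Set G, IsCompact K ∧ ∀ V ∈ 𝒵, V ⊆ K

end Representations

end

/-! The integrated form `T(f) = ∫ π(f(r)) U_r dr` turns two operations on functions into operators
on `X`: `π(a) T(f) = T(a f)` and `U_s T(f) = T(α_s(f(s⁻¹ ·)))`. The vectors `T(f)x` with `f` in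
`C_c(G, A)` span a dense subspace, so these identities determine `(π, U)`. This gives injectivity
(`eq_of_integrated_eq`) and tells how to build the pair from `T`.

From pairs to `T`: the growth condition on `U` dominates the integral by the weighted norm, Fubini
and covariance give multiplicativity (`integrated_twistedConv`), and a closed cone contains the
integrals of its compactly supported continuous functions.

From `T` to pairs: neither left multiplication by `a` nor translation by `s` need come from an
element of the algebra, but both are limits of elements `z ⊗ b`. If `z` concentrates at `s` and the
bounded left multipliers `b` converge strongly to `L`, then `(z ⊗ b) * f` tends to `L ∘ α_s(f(s⁻¹
·))` in the weighted norm (`IsApproxDelta.tendsto_twistedConv`). Hence `T(z ⊗ b)` converges on the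
vectors `T(f)x`, and boundedness of the net carries the convergence to all of `X`
(`exists_strong_limit`, combined in `exists_limit`). Taking `s = e` and `b = a` or `b = a u_i`
yields `π(a)`; taking `b = u_i` yields `U_s`. The limit is identified by its action on the `T(f)x`,
so it cannot depend on the choices, and positivity and norm bounds pass to it. Finally `T` is
recovered by moving an integral of functions inside `T` (`integral_toWeightedL1`).

Throughout, boundedness of the weight on compact sets makes uniform convergence with supports in a
fixed compact set imply convergence in the weighted norm. -/

noncomputable section

/-! ### Nets of operators and integrals in closed cones -/

section Operators

variable {X : Type*} [NormedAddCommGroup X] [NormedSpace ℝ X]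

/-- A bounded net of operators which converges at the points of a set with dense span converges
strongly to a bounded operator. -/
lemma exists_strong_limit [CompleteSpace X] {κ : Type*} {l : Filter κ} [l.NeBot]
    {S : κ → X →L[ℝ] X} {C : ℝ} (hS : ∀ q, ‖S q‖ ≤ C) {E : Set X}
    (hE : Dense (Submodule.span ℝ E : Set X))
    (hc : ∀ y ∈ E, ∃ y', Tendsto (fun q => S q y) l (𝓝 y')) :
    ∃ S' : X →L[ℝ] X, ‖S'‖ ≤ C ∧ ∀ x, Tendsto (fun q => S q x) l (𝓝 (S' x)) := by
  have hC : 0 ≤ C := by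
    obtain ⟨q⟩ := l.nonempty_of_neBot
    exact (norm_nonneg _).trans (hS q)
  let W : Submodule ℝ X :=
    { carrier := {y | ∃ y', Tendsto (fun q => S q y) l (𝓝 y')}
      add_mem' := by
        rintro a b ⟨a', ha⟩ ⟨b', hb⟩
        exact ⟨a' + b', by simpa using ha.add hb⟩
      zero_mem' := ⟨0, by simp⟩
      smul_mem' := by
        rintro c a ⟨a', ha⟩
        exact ⟨c • a', by simpa using ha.const_smul c⟩ }
  have hW : Dense (W : Set X) := hE.mono (Submodule.span_le.2 hc)
  have hall : ∀ x, ∃ y', Tendsto (fun q => S q x) l (𝓝 y') := by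
    intro x
    refine cauchy_map_iff_exists_tendsto.1 (Metric.cauchy_iff.2 ⟨inferInstance, fun ε hε => ?_⟩)
    -- Replacing `x` by `w` costs at most `ε / 4` for every operator in the net, and `S q w` is
    -- eventually within `ε / 4` of its limit. Two indices use four such terms. The `C + 1` covers
    -- the case `C = 0`.
    obtain ⟨w, ⟨y', hw⟩, hxw⟩ := hW.exists_dist_lt x (show 0 < ε / (4 * (C + 1)) by positivity)
    have hxw' : ∀ q, ‖S q x - S q w‖ ≤ ε / 4 := fun q => by
      rw [← map_sub]
      rw [dist_eq_norm] at hxw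
      calc ‖S q (x - w)‖ ≤ C * (ε / (4 * (C + 1))) :=
            ((S q).le_of_opNorm_le (hS q) _).trans (mul_le_mul_of_nonneg_left hxw.le hC)
        _ ≤ (C + 1) * (ε / (4 * (C + 1))) := by gcongr; linarith
        _ = ε / 4 := by field_simp
    have hev := Metric.tendsto_nhds.1 hw (ε / 4) (by positivity)
    refine ⟨(fun q => S q x) '' {q | dist (S q w) y' < ε / 4}, image_mem_map hev, ?_⟩
    rintro _ ⟨p, hp, rfl⟩ _ ⟨q, hq, rfl⟩
    have h1 := hxw' p
    have h2 := hxw' q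
    rw [← dist_eq_norm] at h1 h2
    simp only [mem_ofPred_eq] at hp hq
    calc dist (S p x) (S q x) ≤ dist (S p x) (S p w) + dist (S p w) y' +
          (dist (S q w) y' + dist (S q x) (S q w)) := by
          have := dist_triangle4 (S p x) (S p w) y' (S q x)
          have h3 := dist_triangle_left y' (S q x) (S q w)
          rw [dist_comm (S q w) (S q x)] at h3
          linarith
      _ < ε := by linarith
  choose g hg using hall
  have hgb : ∀ x, ‖g x‖ ≤ C * ‖x‖ := fun x =>
    le_of_tendsto (hg x).norm (Eventually.of_forall fun q => (S q).le_of_opNorm_le (hS q) x)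
  let g' : X →ₗ[ℝ] X :=
    { toFun := g
      map_add' := fun x y => tendsto_nhds_unique (hg (x + y)) (by simpa using (hg x).add (hg y))
      map_smul' := fun c x =>
        tendsto_nhds_unique (hg (c • x)) (by simpa using (hg x).const_smul c) }
  exact ⟨g'.mkContinuous C hgb, g'.mkContinuous_norm_le hC hgb, hg⟩

/-- A bounded net of operators which converges to a given operator at the points of a set with
dense span converges strongly to that operator. -/
lemma tendsto_of_tendsto_on_dense [CompleteSpace X] {κ : Type*} {l : Filter κ} [l.NeBot]
    {S : κ → X →L[ℝ] X} {C : ℝ} (hS : ∀ q, ‖S q‖ ≤ C) {E : Set X}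
    (hE : Dense (Submodule.span ℝ E : Set X)) {S' : X →L[ℝ] X}
    (hc : ∀ y ∈ E, Tendsto (fun q => S q y) l (𝓝 (S' y))) (x : X) :
    Tendsto (fun q => S q x) l (𝓝 (S' x)) := by
  obtain ⟨S'', -, h⟩ := exists_strong_limit hS hE fun y hy => ⟨_, hc y hy⟩
  have : S'' = S' :=
    ContinuousLinearMap.ext_on hE fun y hy => tendsto_nhds_unique (h y) (hc y hy)
  exact this ▸ h x

/-- The integral of a compactly supported continuous function with values in a closed cone is in
the cone. -/
lemma PointedCone.integral_mem_of_hasCompactSupport [CompleteSpace X] {G : Type*}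
    [TopologicalSpace G] [MeasurableSpace G] [OpensMeasurableSpace G] (μ : Measure G)
    [IsFiniteMeasureOnCompacts μ] {P : PointedCone ℝ X} (hP : IsClosed (P : Set X)) {f : G → X}
    (hf : Continuous f) (hfs : HasCompactSupport f) (h : ∀ r, f r ∈ P) : ∫ r, f r ∂μ ∈ P := by
  -- Averages over a set of positive finite measure stay in a closed convex set, and the integral is
  -- a non-negative multiple of the average over the support. A null support admits no such average,
  -- but then the integral is `0`.
  by_cases h0 : μ (tsupport f) = 0
  · have : ∫ r in tsupport f, f r ∂μ = 0 := by
      rw [Measure.restrict_eq_zero.2 h0, integral_zero_measure]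
    rw [setIntegral_eq_integral_of_forall_compl_eq_zero
      fun x hx => image_eq_zero_of_notMem_tsupport hx] at this
    rw [this]
    exact P.zero_mem
  · have hint := hf.integrable_of_hasCompactSupport (μ := μ) hfs
    have htop : μ (tsupport f) ≠ ⊤ := hfs.isCompact.measure_lt_top.ne
    have hm := P.convex.set_average_mem hP h0 htop (Eventually.of_forall h) hint.integrableOn
    have hs : μ.real (tsupport f) • (⨍ x in tsupport f, f x ∂μ) = ∫ r, f r ∂μ := by
      rw [measure_smul_setAverage _ htop, setIntegral_eq_integral_of_forall_compl_eq_zero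
        fun x hx => image_eq_zero_of_notMem_tsupport hx]
    rw [← hs]
    exact P.smul_mem measureReal_nonneg hm

end Operators

/-- A jointly continuous family of functions varies uniformly little over a compact set. -/
lemma eventually_norm_sub_le_of_continuous {Y G X : Type*}
    [TopologicalSpace Y] [TopologicalSpace G] [SeminormedAddCommGroup X] {F : Y → G → X}
    (hF : Continuous F.uncurry) {K : Set G} (hK : IsCompact K) (y₀ : Y) {ε : ℝ} (hε : 0 < ε) :
    ∀ᶠ y in 𝓝 y₀, ∀ t ∈ K, ‖F y t - F y₀ t‖ ≤ ε := by
  obtain ⟨v, hv, h⟩ := hK.mem_uniformity_of_prod (s := univ) (q := y₀) hF.continuousOn (mem_univ _)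
    (Metric.dist_mem_uniformity hε)
  rw [nhdsWithin_univ] at hv
  filter_upwards [hv] with y hy t ht
  rw [← dist_eq_norm]
  exact (h y hy t ht).le

/-! ### The canonical map into the weighted space -/

section ToWeightedL1

variable {G : Type*} [Group G] [TopologicalSpace G] [IsTopologicalGroup G] [LocallyCompactSpace G]
  [MeasurableSpace G] [BorelSpace G] (μ : Measure G) [μ.IsHaarMeasure] (ω : GroupWeight G)
  {X : Type*} [NormedAddCommGroup X]

lemma denseRange_toWeightedL1 : DenseRange (toWeightedL1 μ ω : C_c(G, X) → WeightedL1 μ ω X) :=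
  UniformSpace.Completion.denseRange_coe (α := WeightedCc μ ω X)

lemma norm_toWeightedL1 (f : C_c(G, X)) : ‖toWeightedL1 μ ω f‖ = ∫ s, ‖f s‖ * ω s ∂μ :=
  (UniformSpace.Completion.norm_coe (WeightedCc.of μ ω f)).trans (WeightedCc.norm_def _)

/-- The weighted norm is dominated by the uniform norm on functions supported in a fixed compact
set. -/
lemma norm_toWeightedL1_le_of_support [T2Space G] {K : Set G} (hK : IsCompact K) {ε : ℝ}
    (f : C_c(G, X)) (hf : ∀ s, ‖f s‖ ≤ ε) (hs : ∀ s ∉ K, f s = 0) :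
    ‖toWeightedL1 μ ω f‖ ≤ ε * (ω.weightedMeasure μ).real K := by
  rw [norm_toWeightedL1, ← ω.integral_weightedMeasure,
    ← setIntegral_eq_integral_of_forall_compl_eq_zero (s := K) fun s h => by simp [hs s h]]
  refine (le_abs_self _).trans ((Real.norm_eq_abs _).ge.trans
    (norm_setIntegral_le_of_norm_le_const hK.measure_lt_top
    fun s _ => ?_))
  simpa using hf s

variable [NormedSpace ℝ X]

/-- The canonical map `C_c(G, X) → L¹(G, X, ω)` as a linear map. -/
def toWeightedL1ₗ : C_c(G, X) →ₗ[ℝ] WeightedL1 μ ω X where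
  toFun := toWeightedL1 μ ω
  map_add' f g := UniformSpace.Completion.coe_add (WeightedCc.of μ ω f) (WeightedCc.of μ ω g)
  map_smul' c f := UniformSpace.Completion.coe_smul c (WeightedCc.of μ ω f)

@[simp] lemma toWeightedL1ₗ_apply (f : C_c(G, X)) : toWeightedL1ₗ μ ω f = toWeightedL1 μ ω f := rfl

/-- A family of functions with supports in a fixed compact set which converges uniformly converges
in the weighted norm. -/
lemma tendsto_toWeightedL1 [T2Space G] {κ : Type*} {l : Filter κ} {F : κ → C_c(G, X)}
    {F₀ : C_c(G, X)} {K : Set G} (hK : IsCompact K) (hF₀ : ∀ t ∉ K, F₀ t = 0)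
    (hF : ∀ᶠ q in l, ∀ t ∉ K, F q t = 0)
    (h : ∀ ε > 0, ∀ᶠ q in l, ∀ t ∈ K, ‖F q t - F₀ t‖ ≤ ε) :
    Tendsto (fun q => toWeightedL1 μ ω (F q)) l (𝓝 (toWeightedL1 μ ω F₀)) := by
  rw [Metric.tendsto_nhds]
  intro ε hε
  set c := (ω.weightedMeasure μ).real K with hc
  have hc0 : 0 ≤ c := measureReal_nonneg
  filter_upwards [hF, h (ε / (2 * (c + 1))) (by positivity)] with q hq1 hq2
  rw [dist_eq_norm, ← toWeightedL1ₗ_apply, ← toWeightedL1ₗ_apply, ← map_sub, toWeightedL1ₗ_apply]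
  have hz : ∀ t ∉ K, (F q - F₀) t = 0 := fun t ht => by simp [hq1 t ht, hF₀ t ht]
  calc ‖toWeightedL1 μ ω (F q - F₀)‖ ≤ ε / (2 * (c + 1)) * c := by
        refine norm_toWeightedL1_le_of_support μ ω hK _ (fun s => ?_) hz
        by_cases hs : s ∈ K
        · exact hq2 s hs
        · rw [hz s hs, norm_zero]; positivity
    _ ≤ ε / (2 * (c + 1)) * (c + 1) := by gcongr; linarith
    _ = ε / 2 := by field_simp
    _ < ε := half_lt_self hε

/-- Evaluating the integral of a family of functions supported in a fixed compact set after
applying a bounded operator on the weighted space. -/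
lemma integral_toWeightedL1 [T2Space G] [CompleteSpace X] {Y : Type*} [NormedAddCommGroup Y]
    [NormedSpace ℝ Y] [CompleteSpace Y] (J : WeightedL1 μ ω X →L[ℝ] Y) {F : G → C_c(G, X)}
    (hF : Continuous fun p : G × G => F p.1 p.2) {K K' : Set G} (hK : IsCompact K)
    (hK' : IsCompact K') (hFK : ∀ r, ∀ t ∉ K, F r t = 0) (hFK' : ∀ r ∉ K', F r = 0)
    {F₀ : C_c(G, X)} (hF₀ : ∀ t, F₀ t = ∫ r, F r t ∂μ) :
    ∫ r, J (toWeightedL1 μ ω (F r)) ∂μ = J (toWeightedL1 μ ω F₀) := by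
  -- Point evaluation need not be continuous for the weighted norm, so the family is integrated in
  -- the Banach space of bounded continuous functions, where it is. Multiplication by the cut-off
  -- `χ`, equal to `1` on `K`, leads back to `C_c(G, X)` boundedly and fixes every function
  -- vanishing off `K`.
  obtain ⟨χ, hχK, hχc, -, hχ⟩ := exists_continuousMap_one_of_isCompact_subset_isOpen hK isOpen_univ
    (subset_univ K)
  let cut : (BoundedContinuousFunction G X) → C_c(G, X) := fun h =>
    { toFun := fun t => χ t • h t
      continuous_toFun := χ.continuous.smul h.continuous
      hasCompactSupport' := HasCompactSupport.smul_right hχc }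
  have hcut : ∀ h t, cut h t = χ t • h t := fun _ _ => rfl
  let J₀ : (BoundedContinuousFunction G X) →ₗ[ℝ] Y :=
    { toFun := fun h => J (toWeightedL1ₗ μ ω (cut h))
      map_add' := fun f g => by
        rw [← map_add, ← map_add]; congr 2; ext t; simp [hcut]
      map_smul' := fun c f => by
        rw [RingHom.id_apply, ← map_smul, ← map_smul]; congr 2; ext t
        simp [hcut, smul_comm c] }
  let J₁ : (BoundedContinuousFunction G X) →L[ℝ] Y :=
    J₀.mkContinuous (‖J‖ * (ω.weightedMeasure μ).real (tsupport χ)) fun h => by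
      refine (J.le_opNorm _).trans ?_
      rw [mul_assoc]
      refine mul_le_mul_of_nonneg_left ?_ (norm_nonneg _)
      rw [mul_comm]
      refine norm_toWeightedL1_le_of_support μ ω hχc _ (fun s => ?_) fun s hs => ?_
      · rw [hcut, norm_smul, Real.norm_of_nonneg (hχ s).1]
        exact (mul_le_of_le_one_left (norm_nonneg _) (hχ s).2).trans (h.norm_coe_le_norm s)
      · rw [hcut, image_eq_zero_of_notMem_tsupport hs, zero_smul]
  choose b hb using fun r =>
    (F r).hasCompactSupport.exists_bound_of_continuous (F r).continuous
  let H : G → BoundedContinuousFunction G X := fun r =>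
    BoundedContinuousFunction.ofNormedAddCommGroup (F r) (F r).continuous (b r) (hb r)
  have hH : ∀ r t, H r t = F r t := fun _ _ => rfl
  have hHc : Continuous H := by
    rw [continuous_iff_continuousAt]
    intro r₀
    rw [ContinuousAt, Metric.tendsto_nhds]
    intro ε hε
    filter_upwards [eventually_norm_sub_le_of_continuous (F := fun r t => F r t) hF hK r₀
      (half_pos hε)] with r hr
    refine lt_of_le_of_lt ((BoundedContinuousFunction.dist_le (half_pos hε).le).2 fun t => ?_)
      (half_lt_self hε)
    by_cases ht : t ∈ K
    · rw [dist_eq_norm]; exact hr t ht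
    · rw [hH, hH, hFK r t ht, hFK r₀ t ht, dist_self]; exact (half_pos hε).le
  have hHs : HasCompactSupport H := HasCompactSupport.intro hK' fun r hr => by
    ext t
    rw [hH, hFK' r hr]; rfl
  have hHi : Integrable H μ := hHc.integrable_of_hasCompactSupport hHs
  have h1 := J₁.integral_comp_comm hHi
  have h2 : ∀ r, J₁ (H r) = J (toWeightedL1 μ ω (F r)) := fun r => by
    change J (toWeightedL1 μ ω (cut (H r))) = _
    congr 2
    ext t
    rw [hcut, hH]
    by_cases ht : t ∈ K
    · rw [hχK ht, Pi.one_apply, one_smul]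
    · rw [hFK r t ht, smul_zero]
  simp only [h2] at h1
  rw [h1]
  change J (toWeightedL1 μ ω (cut (∫ r, H r ∂μ))) = _
  congr 2
  ext t
  -- Evaluation at `t` commutes with the Bochner integral, which identifies that integral with `F₀`.
  have h3 := (BoundedContinuousFunction.evalCLM ℝ t : BoundedContinuousFunction G X →L[ℝ] X)
    |>.integral_comp_comm hHi
  have h4 : (∫ r, H r ∂μ) t = F₀ t := by
    rw [hF₀ t]; exact h3.symm
  rw [hcut, h4]
  by_cases ht : t ∈ K
  · rw [hχK ht, Pi.one_apply, one_smul]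
  · rw [hF₀ t]; simp [hFK _ t ht]

end ToWeightedL1

/-! ### Operations on compactly supported functions -/

section CcOperations

variable {G A : Type*} [TopologicalSpace G] [NonUnitalNormedRing A] [NormedSpace ℝ A]

/-- Applying a bounded operator pointwise. -/
def ccMap (L : A →L[ℝ] A) (f : C_c(G, A)) : C_c(G, A) where
  toFun r := L (f r)
  continuous_toFun := L.continuous.comp f.continuous
  hasCompactSupport' := f.hasCompactSupport.comp_left (map_zero L)

@[simp] lemma ccMap_apply (L : A →L[ℝ] A) (f : C_c(G, A)) (r : G) : ccMap L f r = L (f r) := rfl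

@[simp] lemma ccMap_id (f : C_c(G, A)) : ccMap (.id ℝ A) f = f := by ext; rfl

@[simp] lemma ccTensor_apply (z : C_c(G, ℝ)) (a : A) (r : G) : ccTensor z a r = z r • a := rfl

variable [Group G] [IsTopologicalGroup G]

/-- The action `(s, f) ↦ α_s(f(s⁻¹ ·))` of `G` on `C_c(G, A)`. -/
def ccShift (D : PreorderedDynamicalSystem G A) (s : G) (f : C_c(G, A)) : C_c(G, A) where
  toFun r := D.α s (f (s⁻¹ * r))
  continuous_toFun := (D.α s).continuous.comp (f.continuous.comp (continuous_const_mul s⁻¹))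
  hasCompactSupport' := (f.hasCompactSupport.comp_homeomorph (Homeomorph.mulLeft s⁻¹)).comp_left
    (map_zero (D.α s))

variable {D : PreorderedDynamicalSystem G A}

@[simp] lemma ccShift_apply (s : G) (f : C_c(G, A)) (r : G) :
    ccShift D s f r = D.α s (f (s⁻¹ * r)) := rfl

@[simp] lemma ccShift_one (f : C_c(G, A)) : ccShift D 1 f = f := by
  ext r
  rw [ccShift_apply, map_one, inv_one, one_mul]; rfl

lemma ccShift_mul (s t : G) (f : C_c(G, A)) :
    ccShift D (s * t) f = ccShift D s (ccShift D t f) := by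
  ext r
  simp only [ccShift_apply, map_mul, mul_inv_rev, mul_assoc]; rfl

lemma ccShift_eq_zero_of_notMem {K : Set G} {s t : G} (f : C_c(G, A)) (hs : s ∈ K)
    (ht : t ∉ K * tsupport f) : ccShift D s f t = 0 := by
  have : s⁻¹ * t ∉ tsupport f := fun h => ht ⟨s, hs, s⁻¹ * t, h, mul_inv_cancel_left s t⟩
  rw [ccShift_apply, image_eq_zero_of_notMem_tsupport this, map_zero]

lemma continuous_uncurry_ccShift (hα : D.UniformlyBounded) (f : C_c(G, A)) :
    Continuous fun p : G × G => ccShift D p.1 f p.2 :=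
  (PreorderedDynamicalSystem.continuous_uncurry_α hα).comp
    (f := fun p : G × G => (p.1, f (p.1⁻¹ * p.2)))
    (continuous_fst.prodMk (f.continuous.comp (by fun_prop)))

variable [T2Space G] [LocallyCompactSpace G] [MeasurableSpace G] [BorelSpace G]
  (μ : Measure G) [μ.IsHaarMeasure] (ω : GroupWeight G)

/-- For `s` in a compact neighbourhood `N`, all the translates are supported in `N * tsupport f`,
and joint continuity makes them vary uniformly little there. -/
lemma continuous_toWeightedL1_ccShift (hα : D.UniformlyBounded) (f : C_c(G, A)) :
    Continuous fun s => toWeightedL1 μ ω (ccShift D s f) := by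
  rw [continuous_iff_continuousAt]
  intro s
  obtain ⟨N, hN, hNs⟩ := exists_compact_mem_nhds s
  have hK : IsCompact (N * tsupport f) := hN.mul f.hasCompactSupport
  refine tendsto_toWeightedL1 μ ω hK
    (fun t ht => ccShift_eq_zero_of_notMem f (mem_of_mem_nhds hNs) ht)
    (by filter_upwards [hNs] with r hr t ht using ccShift_eq_zero_of_notMem f hr ht)
    fun ε hε => eventually_norm_sub_le_of_continuous (F := fun r t => ccShift D r f t)
      (continuous_uncurry_ccShift hα f) hK s hε

end CcOperations

/-! ### Neighbourhood bases of the identity -/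

section NhdsBase

variable {G : Type*} [Group G] [TopologicalSpace G]

lemma IsCompactlyBoundedNhdsBase.nonempty {𝒵 : Set (Set G)} (h : IsCompactlyBoundedNhdsBase 𝒵) :
    Nonempty 𝒵 := by
  obtain ⟨V, hV, -⟩ := h.hasBasis.mem_iff.1 univ_mem
  exact ⟨V, hV⟩

lemma IsCompactlyBoundedNhdsBase.isDirectedOrder {𝒵 : Set (Set G)}
    (h : IsCompactlyBoundedNhdsBase 𝒵) : IsDirectedOrder (𝒵)ᵒᵈ where
  directed V W := by
    obtain ⟨V', hV', hsub⟩ := h.hasBasis.mem_iff.1 (inter_mem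
      (h.hasBasis.mem_of_mem (OrderDual.ofDual V).2) (h.hasBasis.mem_of_mem (OrderDual.ofDual W).2))
    exact ⟨OrderDual.toDual ⟨V', hV'⟩, fun x hx => (hsub hx).1, fun x hx => (hsub hx).2⟩

lemma IsCompactlyBoundedNhdsBase.neBot_atTop {𝒵 : Set (Set G)}
    (h : IsCompactlyBoundedNhdsBase 𝒵) (ι : Type*) [Preorder ι] [IsDirectedOrder ι] [Nonempty ι] :
    (atTop : Filter ((𝒵)ᵒᵈ × ι)).NeBot := by
  have := h.nonempty
  have := h.isDirectedOrder
  rw [← prod_atTop_atTop_eq]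
  infer_instance

lemma eventually_subset_of_reverse_inclusion {G : Type*} {𝒵 : Set (Set G)} (ι : Type*) [Preorder ι]
    [Nonempty ι] (V : 𝒵) :
    ∀ᶠ q : (𝒵)ᵒᵈ × ι in atTop, ((OrderDual.ofDual q.1 : 𝒵) : Set G) ⊆ V := by
  obtain ⟨i⟩ := ‹Nonempty ι›
  filter_upwards [Ici_mem_atTop ((OrderDual.toDual V, i) : (𝒵)ᵒᵈ × ι)] with q hq
  exact hq.1

/-- An auxiliary base for constructing limits. Since all its members lie in `V`, the resulting
operators have norm bounds involving only the values of the weight on `V`. -/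
lemma isCompactlyBoundedNhdsBase_of_subset_compact {V K : Set G} (hV : V ∈ 𝓝 1) (hK : IsCompact K)
    (hVK : V ⊆ K) : IsCompactlyBoundedNhdsBase {W : Set G | W ∈ 𝓝 1 ∧ W ⊆ V} where
  hasBasis := ⟨fun W => ⟨fun hW => ⟨W ∩ V, ⟨inter_mem hW hV, inter_subset_right⟩,
    inter_subset_left⟩, fun ⟨_, hV', hVW⟩ => mem_of_superset hV'.1 hVW⟩⟩
  exists_compact := ⟨K, hK, fun _ hW => hW.2.trans hVK⟩

end NhdsBase

/-! ### Approximations of point masses -/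

section ApproxDelta

/-- The average of a function against an approximate point mass is close to its value. -/
lemma norm_integral_smul_sub_le {G X : Type*} [TopologicalSpace G]
    [MeasurableSpace G] [BorelSpace G] [NormedAddCommGroup X] [NormedSpace ℝ X]
    [CompleteSpace X] (μ : Measure G) [IsFiniteMeasureOnCompacts μ] {z : C_c(G, ℝ)}
    (hz0 : ∀ r, 0 ≤ z r) (hz1 : ∫ r, z r ∂μ = 1) {h : G → X} (hh : Continuous h) {x : X} {ε : ℝ}
    (hε : ∀ r ∈ Function.support z, ‖h r - x‖ ≤ ε) : ‖∫ r, z r • h r ∂μ - x‖ ≤ ε := by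
  have hi : Integrable (fun r => z r • h r) μ :=
    (z.continuous.smul hh).integrable_of_hasCompactSupport z.hasCompactSupport.smul_right
  have hx : ∫ r, z r • x ∂μ = x := by rw [integral_smul_const, hz1, one_smul]
  have h1 : ∫ r, z r • h r ∂μ - x = ∫ r, z r • (h r - x) ∂μ := by
    simp only [smul_sub]
    rw [integral_sub hi (z.integrable.smul_const x), hx]
  rw [h1]
  calc ‖∫ r, z r • (h r - x) ∂μ‖ ≤ ∫ r, z r * ε ∂μ := by
        refine norm_integral_le_of_norm_le (z.integrable.mul_const ε)
          (Eventually.of_forall fun r => ?_)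
        rw [norm_smul, Real.norm_of_nonneg (hz0 r)]
        by_cases hr : z r = 0
        · simp [hr]
        · exact mul_le_mul_of_nonneg_left (hε r hr) (hz0 r)
    _ = ε := by rw [integral_mul_const, hz1, one_mul]

variable {G : Type*} [TopologicalSpace G] [MeasurableSpace G]

/-- A net of non-negative functions in `C_c(G)` with integral `1` and with supports in a fixed
compact set, which concentrates at `s`. -/
structure IsApproxDelta (μ : Measure G) {κ : Type*} (l : Filter κ) (s : G) (z : κ → C_c(G, ℝ)) :
    Prop where
  nonneg : ∀ q r, 0 ≤ z q r
  integral_eq_one : ∀ q, ∫ r, z q r ∂μ = 1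
  exists_compact : ∃ K : Set G, IsCompact K ∧ ∀ q, Function.support (z q) ⊆ K
  eventually_support : ∀ W ∈ 𝓝 s, ∀ᶠ q in l, Function.support (z q) ⊆ W

lemma IsApproxDelta.tendsto_integral_smul [BorelSpace G] {X : Type*} [NormedAddCommGroup X]
    [NormedSpace ℝ X] [CompleteSpace X] {μ : Measure G} [IsFiniteMeasureOnCompacts μ] {κ : Type*} {l : Filter κ}
    {s : G} {z : κ → C_c(G, ℝ)} (hz : IsApproxDelta μ l s z) {h : G → X} (hh : Continuous h) :
    Tendsto (fun q => ∫ r, z q r • h r ∂μ) l (𝓝 (h s)) := by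
  rw [Metric.tendsto_nhds]
  intro ε hε
  have hW := Metric.tendsto_nhds.1 (hh.tendsto s) (ε / 2) (half_pos hε)
  filter_upwards [hz.eventually_support _ hW] with q hq
  rw [dist_eq_norm]
  refine lt_of_le_of_lt (norm_integral_smul_sub_le μ (hz.nonneg q) (hz.integral_eq_one q) hh
    fun r hr => ?_) (half_lt_self hε)
  rw [← dist_eq_norm]
  exact (show dist (h r) (h s) < ε / 2 from hq hr).le

variable [Group G]

lemma IsApproxDelta.translate [IsTopologicalGroup G] [BorelSpace G] {μ : Measure G}
    [μ.IsMulLeftInvariant] {κ : Type*} {l : Filter κ} {z : κ → C_c(G, ℝ)}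
    (hz : IsApproxDelta μ l 1 z) (s : G) :
    IsApproxDelta μ l s fun q => ccTranslate s (z q) where
  nonneg q r := hz.nonneg q _
  integral_eq_one q := (integral_mul_left_eq_self (z q) s⁻¹).trans (hz.integral_eq_one q)
  exists_compact := by
    obtain ⟨K, hK, h⟩ := hz.exists_compact
    exact ⟨s • K, hK.smul s, fun q r hr => ⟨s⁻¹ * r, h q hr, by simp⟩⟩
  eventually_support W hW := by
    have : (s * ·) ⁻¹' W ∈ 𝓝 (1 : G) :=
      (continuous_const_mul s).continuousAt.preimage_mem_nhds (by simpa using hW)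
    filter_upwards [hz.eventually_support _ this] with q hq r hr
    simpa using hq (show s⁻¹ * r ∈ Function.support (z q) from hr)

lemma IsCompactlyBoundedNhdsBase.isApproxDelta {𝒵 : Set (Set G)}
    (h : IsCompactlyBoundedNhdsBase 𝒵) {μ : Measure G} {z : 𝒵 → C_c(G, ℝ)}
    (hz : ∀ V : 𝒵, (∀ r, 0 ≤ z V r) ∧ Function.support (z V) ⊆ V ∧ ∫ r, z V r ∂μ = 1)
    (ι : Type*) [Preorder ι] [Nonempty ι] :
    IsApproxDelta μ (atTop : Filter ((𝒵)ᵒᵈ × ι)) 1 fun q => z (OrderDual.ofDual q.1) where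
  nonneg q := (hz _).1
  integral_eq_one q := (hz _).2.2
  exists_compact := by
    obtain ⟨K, hK, h'⟩ := h.exists_compact
    exact ⟨K, hK, fun q => (hz _).2.1.trans (h' _ (Subtype.prop _))⟩
  eventually_support W hW := by
    obtain ⟨V, hV, hVW⟩ := h.hasBasis.mem_iff.1 hW
    filter_upwards [eventually_subset_of_reverse_inclusion ι (⟨V, hV⟩ : 𝒵)] with q hq
    exact (hz _).2.1.trans (hq.trans hVW)

variable [IsTopologicalGroup G] [LocallyCompactSpace G] [BorelSpace G]

/-- Every neighbourhood of the identity carries a non-negative function with integral `1`. -/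
lemma exists_bump (μ : Measure G) [μ.IsHaarMeasure] {V : Set G} (hV : V ∈ 𝓝 (1 : G)) :
    ∃ z : C_c(G, ℝ), (∀ r, 0 ≤ z r) ∧ Function.support z ⊆ V ∧ ∫ r, z r ∂μ = 1 := by
  obtain ⟨f, hf1, hfc, hfV, hf⟩ := exists_continuousMap_one_of_isCompact_subset_isOpen
    (isCompact_singleton (x := (1 : G))) isOpen_interior
    (singleton_subset_iff.2 (mem_interior_iff_mem_nhds.2 hV))
  have hpos : 0 < ∫ r, f r ∂μ :=
    f.continuous.integral_pos_of_hasCompactSupport_nonneg_nonzero hfc (fun r => (hf r).1)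
      (x := 1) (by rw [hf1 rfl]; exact one_ne_zero)
  refine ⟨(∫ r, f r ∂μ)⁻¹ • ⟨f, hfc⟩, fun r => ?_, fun r hr => ?_, ?_⟩
  · exact mul_nonneg (inv_nonneg.2 hpos.le) (hf r).1
  · exact interior_subset (hfV (subset_tsupport _ fun h => hr (by
      change (∫ r, f r ∂μ)⁻¹ * f r = 0
      rw [h, mul_zero])))
  · change ∫ r, (∫ r, f r ∂μ)⁻¹ * f r ∂μ = 1
    rw [integral_const_mul, inv_mul_cancel₀ hpos.ne']

end ApproxDelta

/-! ### Approximate identities of the generalized Beurling algebra -/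

section BeurlingApprox

variable {A : Type*} [NonUnitalNormedRing A]

/-- A bounded net of left multipliers which converges strongly converges uniformly on compact
sets. -/
lemma eventually_norm_mul_sub_le [NormedSpace ℝ A] {κ : Type*} {l : Filter κ} {b : κ → A} {B : ℝ}
    (hb : ∀ q, ‖b q‖ ≤ B) {L : A →L[ℝ] A} (hL : ∀ a, Tendsto (fun q => b q * a) l (𝓝 (L a)))
    {Q : Set A} (hQ : IsCompact Q) {ε : ℝ} (hε : 0 < ε) :
    ∀ᶠ q in l, ∀ a ∈ Q, ‖b q * a - L a‖ ≤ ε := by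
  -- Finitely many `δ`-balls cover `Q`; passing from a point to the centre of its ball costs `(|B| +
  -- ‖L‖) δ ≤ ε / 2`. The absolute value and the `1` keep `δ` positive without a sign hypothesis on
  -- `B`.
  set δ := ε / (2 * (|B| + ‖L‖ + 1)) with hδ
  have hδ0 : 0 < δ := by positivity
  obtain ⟨t, -, htf, ht⟩ := hQ.finite_cover_balls hδ0
  have hev : ∀ᶠ q in l, ∀ c ∈ t, ‖b q * c - L c‖ < ε / 2 := by
    rw [eventually_all_finite htf]
    intro c _
    simpa [dist_eq_norm] using Metric.tendsto_nhds.1 (hL c) (ε / 2) (half_pos hε)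
  filter_upwards [hev] with q hq a ha
  obtain ⟨c, hc, hac⟩ := mem_iUnion₂.1 (ht ha)
  rw [Metric.mem_ball, dist_eq_norm] at hac
  have h1 : ‖b q * (a - c)‖ ≤ |B| * δ := (norm_mul_le _ _).trans
    (mul_le_mul ((hb q).trans (le_abs_self B)) hac.le (norm_nonneg _) (abs_nonneg _))
  have h2 : ‖L (a - c)‖ ≤ ‖L‖ * δ :=
    (L.le_opNorm _).trans (mul_le_mul_of_nonneg_left hac.le (norm_nonneg _))
  calc ‖b q * a - L a‖ = ‖b q * (a - c) - L (a - c) + (b q * c - L c)‖ := by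
        rw [mul_sub, map_sub]; congr 1; abel
    _ ≤ ‖b q * (a - c)‖ + ‖L (a - c)‖ + ‖b q * c - L c‖ :=
        (norm_add_le _ _).trans (add_le_add (norm_sub_le _ _) le_rfl)
    _ ≤ |B| * δ + ‖L‖ * δ + ε / 2 := add_le_add (add_le_add h1 h2) (hq c hc).le
    _ ≤ (|B| + ‖L‖ + 1) * δ + ε / 2 := by nlinarith
    _ = ε := by rw [hδ]; field_simp; ring

variable {G : Type*} [Group G] [TopologicalSpace G] [IsTopologicalGroup G]
  [LocallyCompactSpace G] [MeasurableSpace G] [BorelSpace G] {μ : Measure G} [μ.IsHaarMeasure]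
  (ω : GroupWeight G) [NormedSpace ℝ A]

/-- The norm of `z ⊗ b` is `‖b‖` times the average of the weight against the probability density
`z`. This is where the suprema of the weight in the norm bounds come from. -/
lemma norm_toWeightedL1_ccTensor_le {z : C_c(G, ℝ)} (hz0 : ∀ r, 0 ≤ z r)
    (hz1 : ∫ r, z r ∂μ = 1) {S : ℝ} (hS : ∀ r ∈ Function.support z, ω r ≤ S) (b : A) :
    ‖toWeightedL1 μ ω (ccTensor z b)‖ ≤ S * ‖b‖ := by
  rw [norm_toWeightedL1]
  calc ∫ r, ‖ccTensor z b r‖ * ω r ∂μ ≤ ∫ r, z r * (S * ‖b‖) ∂μ := by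
        refine integral_mono (ω.integrable_norm_mul μ _) (z.integrable.mul_const _) fun r => ?_
        simp only [ccTensor_apply, norm_smul, Real.norm_of_nonneg (hz0 r)]
        by_cases hr : z r = 0
        · simp [hr]
        · calc z r * ‖b‖ * ω r ≤ z r * ‖b‖ * S :=
                mul_le_mul_of_nonneg_left (hS r hr) (mul_nonneg (hz0 r) (norm_nonneg b))
            _ = z r * (S * ‖b‖) := by ring
    _ = S * ‖b‖ := by rw [integral_mul_const, hz1, one_mul]

variable [T2Space G] [IsScalarTower ℝ A A] [SMulCommClass ℝ A A] [CompleteSpace A]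
  {D : PreorderedDynamicalSystem G A}

/-- Convolution with the tensors of an approximate point mass at `s` and a net of left multipliers
converging to `L` approximates `f ↦ L ∘ α_s(f(s⁻¹ ·))`. -/
lemma IsApproxDelta.tendsto_twistedConv (hα : D.UniformlyBounded) {κ : Type*} {l : Filter κ} {s : G}
    {z : κ → C_c(G, ℝ)} (hz : IsApproxDelta μ l s z) {b : κ → A} {B : ℝ} (hb : ∀ q, ‖b q‖ ≤ B)
    {L : A →L[ℝ] A} (hL : ∀ a, Tendsto (fun q => b q * a) l (𝓝 (L a))) (f : C_c(G, A)) :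
    Tendsto (fun q => toWeightedL1 μ ω
        (PreorderedDynamicalSystem.twistedConv hα μ (ccTensor (z q) (b q)) f)) l
      (𝓝 (toWeightedL1 μ ω (ccMap L (ccShift D s f)))) := by
  obtain ⟨K, hK, hzK⟩ := hz.exists_compact
  -- The compact set `K` need not contain the limit point `s`, which is added so that the limit
  -- function is supported in the same compact set.
  have hKK : IsCompact (insert s K * tsupport f) := (hK.insert s).mul f.hasCompactSupport
  -- The convolution is `b` times the `z`-average of the twisted translates of `f`. The average
  -- approaches the translate by `s` uniformly in `t`, and the multipliers converge uniformly on the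
  -- compact image of that translate.
  have hconv : ∀ q t, PreorderedDynamicalSystem.twistedConv hα μ (ccTensor (z q) (b q)) f t =
      b q * ∫ r, z q r • ccShift D r f t ∂μ := by
    intro q t
    have hc : Continuous fun r => ccShift D r f t :=
      (continuous_uncurry_ccShift hα f).comp (Continuous.prodMk_left t)
    have hi : Integrable (fun r => z q r • ccShift D r f t) μ :=
      ((z q).continuous.smul hc).integrable_of_hasCompactSupport
        (z q).hasCompactSupport.smul_right
    refine Eq.trans (integral_congr_ae (Eventually.of_forall fun r => ?_))
      ((ContinuousLinearMap.mul ℝ A (b q)).integral_comp_comm hi)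
    simp [smul_mul_assoc]
  refine tendsto_toWeightedL1 μ ω hKK (fun t ht => ?_) (Eventually.of_forall fun q t ht => ?_)
    fun ε hε => ?_
  · rw [ccMap_apply, ccShift_eq_zero_of_notMem f (mem_insert _ _) ht, map_zero]
  · have : ∀ r, z q r • ccShift D r f t = 0 := fun r => by
      by_cases hr : z q r = 0
      · rw [hr, zero_smul]
      · rw [ccShift_eq_zero_of_notMem f (mem_insert_of_mem _ (hzK q hr)) ht, smul_zero]
    simp only [hconv, this, integral_zero, mul_zero]
  · have hε1 : 0 < ε / (2 * (|B| + 1)) := by positivity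
    have h1 := eventually_norm_sub_le_of_continuous (F := fun r t => ccShift D r f t)
      (continuous_uncurry_ccShift hα f) hKK s hε1
    have h2 := eventually_norm_mul_sub_le hb hL (hKK.image (ccShift D s f).continuous)
      (half_pos hε)
    filter_upwards [hz.eventually_support _ h1, h2] with q hq1 hq2 t ht
    have hc : Continuous fun r => ccShift D r f t :=
      (continuous_uncurry_ccShift hα f).comp (Continuous.prodMk_left t)
    have h3 := norm_integral_smul_sub_le μ (hz.nonneg q) (hz.integral_eq_one q) hc
      (x := ccShift D s f t) fun r hr => hq1 hr t ht
    have h4 := hq2 _ (mem_image_of_mem _ ht)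
    rw [hconv]
    set I := ∫ r, z q r • ccShift D r f t ∂μ
    calc ‖b q * I - ccMap L (ccShift D s f) t‖
        = ‖b q * (I - ccShift D s f t) + (b q * ccShift D s f t - L (ccShift D s f t))‖ := by
          rw [mul_sub, ccMap_apply]; congr 1; abel
      _ ≤ |B| * (ε / (2 * (|B| + 1))) + ε / 2 :=
          (norm_add_le _ _).trans (add_le_add ((norm_mul_le _ _).trans
            (mul_le_mul ((hb q).trans (le_abs_self B)) h3 (norm_nonneg _) (abs_nonneg _))) h4)
      _ ≤ (|B| + 1) * (ε / (2 * (|B| + 1))) + ε / 2 := by gcongr; linarith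
      _ = ε := by field_simp; ring

end BeurlingApprox

/-! ### Representations of the generalized Beurling algebra on the dense subspace -/

section DenseSubspace

variable {G A X : Type*} [Group G] [TopologicalSpace G] [IsTopologicalGroup G]
  [LocallyCompactSpace G] [MeasurableSpace G] [BorelSpace G]
  {μ : Measure G} [μ.IsHaarMeasure] {ω : GroupWeight G}
  [NonUnitalNormedRing A] [NormedSpace ℝ A] [NormedAddCommGroup X] [NormedSpace ℝ X]

lemma ext_of_toWeightedL1 {Y : Type*} [NormedAddCommGroup Y] [NormedSpace ℝ Y]
    {S T : WeightedL1 μ ω A →L[ℝ] Y}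
    (h : ∀ f : C_c(G, A), S (toWeightedL1 μ ω f) = T (toWeightedL1 μ ω f)) : S = T :=
  ContinuousLinearMap.ext fun f => congrFun
    ((denseRange_toWeightedL1 μ ω).equalizer S.continuous T.continuous (funext h)) f

/-- Each `T f x` is a limit of vectors with `f` in `C_c(G, A)`. Operators can thus be compared, and
strong limits tested, on vectors for which convolution is an explicit integral. -/
lemma dense_span_of_toWeightedL1 {T : WeightedL1 μ ω A →L[ℝ] X →L[ℝ] X}
    (h : Dense (Submodule.span ℝ {y : X | ∃ f x, y = T f x} : Set X)) :
    Dense (Submodule.span ℝ {y : X | ∃ (f : C_c(G, A)) (x : X), y = T (toWeightedL1 μ ω f) x} :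
      Set X) := by
  set W := Submodule.span ℝ {y : X | ∃ (f : C_c(G, A)) (x : X), y = T (toWeightedL1 μ ω f) x}
  have hle : Submodule.span ℝ {y : X | ∃ f x, y = T f x} ≤ W.topologicalClosure := by
    refine Submodule.span_le.2 ?_
    rintro _ ⟨f, x, rfl⟩
    refine (denseRange_toWeightedL1 μ ω).induction_on f
      (W.isClosed_topologicalClosure.preimage (by fun_prop : Continuous fun f => T f x)) fun g => ?_
    exact W.le_topologicalClosure (Submodule.subset_span ⟨g, x, rfl⟩)
  exact Dense.of_closure (h.mono hle)

lemma map_beurlingMul_of_toWeightedL1 [T2Space G] [IsScalarTower ℝ A A] [SMulCommClass ℝ A A]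
    {D : PreorderedDynamicalSystem G A} (hα : D.UniformlyBounded)
    {T : WeightedL1 μ ω A →L[ℝ] X →L[ℝ] X}
    (h : ∀ (f g : C_c(G, A)) (x : X),
      T (toWeightedL1 μ ω (PreorderedDynamicalSystem.twistedConv hα μ f g)) x =
        T (toWeightedL1 μ ω f) (T (toWeightedL1 μ ω g) x)) (f g : WeightedL1 μ ω A) (x : X) :
    T (PreorderedDynamicalSystem.beurlingMul hα μ ω f g) x = T f (T g x) := by
  refine (denseRange_toWeightedL1 μ ω).induction_on₂ (p := fun f g =>
    T (PreorderedDynamicalSystem.beurlingMul hα μ ω f g) x = T f (T g x))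
    (isClosed_eq (by fun_prop) (by fun_prop)) (fun f g => ?_) f g
  rw [PreorderedDynamicalSystem.beurlingMul_toWeightedL1, h]

end DenseSubspace

/-! ### The integrated form of a covariant representation -/

namespace PositiveCovariantRep

variable {G A X : Type*} [Group G] [TopologicalSpace G] [MeasurableSpace G]
  [NonUnitalNormedRing A] [NormedSpace ℝ A] [NormedAddCommGroup X] [NormedSpace ℝ X]
  {D : PreorderedDynamicalSystem G A} {ω : GroupWeight G} {Xpos : PointedCone ℝ X}
  (p : PositiveCovariantRep D ω Xpos)

lemma continuous_integrand (f : C_c(G, A)) (x : X) :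
    Continuous fun r => p.π (f r) (p.U r x) :=
  (p.π.continuous.comp f.continuous).clm_apply (p.continuous_U x)

lemma hasCompactSupport_integrand (f : C_c(G, A)) (x : X) :
    HasCompactSupport fun r => p.π (f r) (p.U r x) :=
  HasCompactSupport.intro' f.hasCompactSupport (isClosed_tsupport f) fun r hr => by
    rw [image_eq_zero_of_notMem_tsupport hr, map_zero, _root_.zero_apply]

lemma U_mul_apply (s t : G) (x : X) : p.U (s * t) x = p.U s (p.U t x) := by
  rw [map_mul]; rfl

lemma U_symm_apply (s : G) (x : X) : (p.U s).symm x = p.U s⁻¹ x := by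
  rw [map_inv]; rfl

variable [BorelSpace G]

lemma integrable_integrand (μ : Measure G) [IsFiniteMeasureOnCompacts μ] (f : C_c(G, A)) (x : X) :
    Integrable (fun r => p.π (f r) (p.U r x)) μ :=
  (p.continuous_integrand f x).integrable_of_hasCompactSupport (p.hasCompactSupport_integrand f x)

variable [IsTopologicalGroup G] [LocallyCompactSpace G]
  (μ : Measure G) [μ.IsHaarMeasure]

lemma norm_integral_le {C : ℝ} (hC : ∀ r, ‖(p.U r : X →L[ℝ] X)‖ ≤ C * ω r)
    (f : C_c(G, A)) (x : X) :
    ‖∫ r, p.π (f r) (p.U r x) ∂μ‖ ≤ C * ‖p.π‖ * ‖toWeightedL1 μ ω f‖ * ‖x‖ := by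
  have h1 : ∀ r, ‖p.π (f r) (p.U r x)‖ ≤ C * ‖p.π‖ * ‖x‖ * (‖f r‖ * ω r) := fun r => by
    have h2 : ‖p.π (f r)‖ ≤ ‖p.π‖ * ‖f r‖ := p.π.le_opNorm _
    have h3 : ‖p.U r x‖ ≤ C * ω r * ‖x‖ := (p.U r : X →L[ℝ] X).le_of_opNorm_le (hC r) x
    calc ‖p.π (f r) (p.U r x)‖ ≤ ‖p.π (f r)‖ * ‖p.U r x‖ := (p.π (f r)).le_opNorm _
      _ ≤ ‖p.π‖ * ‖f r‖ * (C * ω r * ‖x‖) :=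
          mul_le_mul h2 h3 (norm_nonneg _) (by positivity)
      _ = C * ‖p.π‖ * ‖x‖ * (‖f r‖ * ω r) := by ring
  calc ‖∫ r, p.π (f r) (p.U r x) ∂μ‖ ≤ ∫ r, C * ‖p.π‖ * ‖x‖ * (‖f r‖ * ω r) ∂μ :=
        norm_integral_le_of_norm_le ((ω.integrable_norm_mul μ f).const_mul _)
          (Eventually.of_forall h1)
    _ = C * ‖p.π‖ * ‖toWeightedL1 μ ω f‖ * ‖x‖ := by
        rw [integral_const_mul, norm_toWeightedL1]; ring

/-- The operators `∫ π(f(r)) U_r dμ(r)` for `f` in `C_c(G, A)`. -/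
def integratedCc : C_c(G, A) →ₗ[ℝ] X →L[ℝ] X where
  toFun f := LinearMap.mkContinuousOfExistsBound
    { toFun := fun x => ∫ r, p.π (f r) (p.U r x) ∂μ
      map_add' := fun x y => by
        simp only [map_add]
        exact integral_add (p.integrable_integrand μ f x) (p.integrable_integrand μ f y)
      map_smul' := fun c x => by
        simp only [map_smul]
        exact integral_smul c _ }
    (by
      obtain ⟨C, -, hC⟩ := p.growth
      exact ⟨_, p.norm_integral_le μ hC f⟩)
  map_add' f g := by
    ext x
    refine Eq.trans (integral_congr_ae (Eventually.of_forall fun r => ?_))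
      (integral_add (p.integrable_integrand μ f x) (p.integrable_integrand μ g x))
    simp
  map_smul' c f := by
    ext x
    refine Eq.trans (integral_congr_ae (Eventually.of_forall fun r => ?_))
      (integral_smul c fun r => p.π (f r) (p.U r x))
    simp

lemma norm_integratedCc_le {C : ℝ} (hC0 : 0 ≤ C)
    (hC : ∀ r, ‖(p.U r : X →L[ℝ] X)‖ ≤ C * ω r) (f : C_c(G, A)) :
    ‖p.integratedCc μ f‖ ≤ C * ‖p.π‖ * ‖toWeightedL1ₗ μ ω f‖ :=
  ContinuousLinearMap.opNorm_le_bound _ (by positivity) (p.norm_integral_le μ hC f)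

variable [CompleteSpace X]

/-- The bounded operator `T^(π,U)` on `L¹(G, A, ω)`. -/
def integrated : WeightedL1 μ ω A →L[ℝ] X →L[ℝ] X :=
  (p.integratedCc μ).extendOfNorm (toWeightedL1ₗ μ ω)

lemma integrated_toWeightedL1 (f : C_c(G, A)) (x : X) :
    p.integrated μ (toWeightedL1 μ ω f) x = ∫ r, p.π (f r) (p.U r x) ∂μ := by
  -- The growth condition supplies the weighted norm bound that the extension to the completion
  -- requires.
  obtain ⟨C, hC0, hC⟩ := p.growth
  exact DFunLike.congr_fun (LinearMap.extendOfNorm_eq (denseRange_toWeightedL1 μ ω)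
    ⟨_, p.norm_integratedCc_le μ hC0 hC⟩ f) x

lemma norm_integrated_le {C : ℝ} (hC0 : 0 ≤ C)
    (hC : ∀ r, ‖(p.U r : X →L[ℝ] X)‖ ≤ C * ω r) : ‖p.integrated μ‖ ≤ C * ‖p.π‖ :=
  LinearMap.opNorm_extendOfNorm_le (denseRange_toWeightedL1 μ ω) (by positivity)
    (p.norm_integratedCc_le μ hC0 hC)

/-- Covariance gives `U_s π(f(r)) U_r = π(α_s(f(r))) U_{sr}`, and left invariance of the measure
substitutes `s⁻¹ r` for `r`. -/
lemma U_integrated (s : G) (f : C_c(G, A)) (x : X) :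
    p.U s (p.integrated μ (toWeightedL1 μ ω f) x) =
      p.integrated μ (toWeightedL1 μ ω (ccShift D s f)) x := by
  rw [integrated_toWeightedL1, integrated_toWeightedL1,
    ← integral_mul_left_eq_self (fun r => p.π (ccShift D s f r) (p.U r x)) s,
    ← ContinuousLinearEquiv.coe_coe,
    ← ContinuousLinearMap.integral_comp_comm _ (p.integrable_integrand μ f x)]
  refine integral_congr_ae (Eventually.of_forall fun r => ?_)
  simp only [ccShift_apply, inv_mul_cancel_left, p.covariant, U_symm_apply, ← U_mul_apply,
    ContinuousLinearEquiv.coe_coe]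

/-- As `z` concentrates at the identity, `T(z ⊗ a)x = ∫ z(r) π(a) U_r x dr` tends to `π(a)x`, so
non-degeneracy of `π` is inherited. -/
lemma integrated_nondegenerate [T2Space G] :
    Dense (Submodule.span ℝ {y : X | ∃ f x, y = p.integrated μ f x} : Set X) := by
  set W := Submodule.span ℝ {y : X | ∃ f x, y = p.integrated μ f x}
  have hle : Submodule.span ℝ {y : X | ∃ a x, y = p.π a x} ≤ W.topologicalClosure := by
    refine Submodule.span_le.2 ?_
    rintro _ ⟨a, x, rfl⟩
    obtain ⟨K, hK, hK1⟩ := exists_compact_mem_nhds (1 : G)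
    have h𝒵 := isCompactlyBoundedNhdsBase_of_subset_compact hK1 hK subset_rfl
    choose z hz using fun V : {W : Set G | W ∈ 𝓝 1 ∧ W ⊆ K} =>
      exists_bump μ (h𝒵.hasBasis.mem_of_mem V.2)
    -- Only the approximate point mass varies, so the second index set is trivial.
    have hδ := h𝒵.isApproxDelta hz Unit
    have := h𝒵.neBot_atTop Unit
    have ht := hδ.tendsto_integral_smul (h := fun r => p.π a (p.U r x))
      ((p.π a).continuous.comp (p.continuous_U x))
    have h1 : p.U 1 x = x := by rw [map_one]; rfl
    simp only [h1] at ht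
    refine W.isClosed_topologicalClosure.mem_of_tendsto ht (Eventually.of_forall fun q => ?_)
    refine W.le_topologicalClosure (Submodule.subset_span
      ⟨toWeightedL1 μ ω (ccTensor (z (OrderDual.ofDual q.1)) a), x, ?_⟩)
    simp [integrated_toWeightedL1]
  exact Dense.of_closure (p.nondegenerate.mono hle)

lemma integrated_positive (hX : IsClosed (Xpos : Set X)) {f : WeightedL1 μ ω A}
    (hf : f ∈ weightedL1Cone μ ω D.cone) {x : X} (hx : x ∈ Xpos) :
    p.integrated μ f x ∈ Xpos := by
  have hc : IsClosed {f : WeightedL1 μ ω A | p.integrated μ f x ∈ Xpos} :=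
    hX.preimage (by fun_prop : Continuous fun f => p.integrated μ f x)
  refine closure_minimal ?_ hc hf
  rintro _ ⟨g, hg, rfl⟩
  rw [mem_ofPred_eq, integrated_toWeightedL1]
  exact PointedCone.integral_mem_of_hasCompactSupport μ hX (p.continuous_integrand g x)
    (p.hasCompactSupport_integrand g x)
    fun r => p.π_positive _ (hg r) _ ((p.U_bipositive r x).2 hx)

/-- Fubini for a continuous compactly supported integrand, which needs no σ-finiteness. After the
exchange, the inner integral over `s` is the integrated form of a translate of `g`, which
`U_integrated` turns into `U_r T(g)x`. -/
lemma integrated_twistedConv [T2Space G] [CompleteSpace A] (hα : D.UniformlyBounded)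
    (f g : C_c(G, A)) (x : X) :
    p.integrated μ (toWeightedL1 μ ω (PreorderedDynamicalSystem.twistedConv hα μ f g)) x =
      p.integrated μ (toWeightedL1 μ ω f) (p.integrated μ (toWeightedL1 μ ω g) x) := by
  let F : G → G → X := fun s r => p.π (f r * ccShift D r g s) (p.U s x)
  have hFc : Continuous F.uncurry := by
    have h1 : Continuous fun q : G × G => p.U q.1 x := (p.continuous_U x).comp continuous_fst
    exact (p.π.continuous.comp
      (PreorderedDynamicalSystem.continuous_convIntegrand hα f g)).clm_apply h1
  have hFs : HasCompactSupport F.uncurry := by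
    refine HasCompactSupport.intro (K := (tsupport f * tsupport g) ×ˢ tsupport f)
      ((IsCompact.mul f.hasCompactSupport g.hasCompactSupport).prod f.hasCompactSupport) ?_
    rintro ⟨s, r⟩ hsr
    have : f r * ccShift D r g s = 0 := by
      by_cases hr : r ∈ tsupport f
      · rw [ccShift_eq_zero_of_notMem g hr fun h => hsr ⟨h, hr⟩, mul_zero]
      · rw [image_eq_zero_of_notMem_tsupport hr, zero_mul]
    simp only [F, Function.uncurry, this, map_zero, _root_.zero_apply]
  have h1 : ∀ s, p.π (PreorderedDynamicalSystem.twistedConv hα μ f g s) (p.U s x) =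
      ∫ r, F s r ∂μ := fun s =>
    ((p.π.flip (p.U s x)).integral_comp_comm
      (PreorderedDynamicalSystem.integrable_convIntegrand hα μ f g s)).symm
  have h2 : ∀ r, ∫ s, F s r ∂μ = p.π (f r) (p.U r (p.integrated μ (toWeightedL1 μ ω g) x)) := by
    intro r
    rw [U_integrated, integrated_toWeightedL1,
      ← ContinuousLinearMap.integral_comp_comm _ (p.integrable_integrand μ _ x)]
    simp only [F, p.π_mul]
  rw [integrated_toWeightedL1, integrated_toWeightedL1]
  simp only [h1, ← h2]
  exact integral_integral_swap_of_hasCompactSupport hFc hFs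

variable [IsScalarTower ℝ A A] [SMulCommClass ℝ A A]

lemma π_integrated (a : A) (f : C_c(G, A)) (x : X) :
    p.π a (p.integrated μ (toWeightedL1 μ ω f) x) =
      p.integrated μ (toWeightedL1 μ ω (ccMap (ContinuousLinearMap.mul ℝ A a) f)) x := by
  rw [integrated_toWeightedL1, integrated_toWeightedL1,
    ← ContinuousLinearMap.integral_comp_comm _ (p.integrable_integrand μ f x)]
  simp [p.π_mul]

variable [T2Space G] [CompleteSpace A]

/-- The integrated form `T^(π,U)` of a positive covariant representation `(π, U)`. -/
def integratedForm (hα : D.UniformlyBounded) (hX : IsClosed (Xpos : Set X)) :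
    PositiveBeurlingRep hα μ ω Xpos where
  T := p.integrated μ
  map_mul := map_beurlingMul_of_toWeightedL1 hα (p.integrated_twistedConv μ hα)
  nondegenerate := p.integrated_nondegenerate μ
  positive _ hf _ hx := p.integrated_positive μ hX hf hx

end PositiveCovariantRep

/-! ### The covariant representation of a representation of the generalized Beurling algebra -/

lemma ccTensor_mem_weightedL1Cone {G A : Type*} [Group G] [TopologicalSpace G]
    [IsTopologicalGroup G] [LocallyCompactSpace G] [MeasurableSpace G] [BorelSpace G]
    (μ : Measure G) [μ.IsHaarMeasure] (ω : GroupWeight G) [NonUnitalNormedRing A] [NormedSpace ℝ A]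
    {P : PointedCone ℝ A} {z : C_c(G, ℝ)} (hz : ∀ r, 0 ≤ z r) {a : A} (ha : a ∈ P) :
    toWeightedL1 μ ω (ccTensor z a) ∈ weightedL1Cone μ ω P :=
  subset_closure ⟨_, fun r => P.smul_mem (hz r) ha, rfl⟩

namespace PositiveBeurlingRep

variable {G A X : Type*} [Group G] [TopologicalSpace G] [IsTopologicalGroup G] [T2Space G]
  [LocallyCompactSpace G] [MeasurableSpace G] [BorelSpace G]
  {μ : Measure G} [μ.IsHaarMeasure] {ω : GroupWeight G}
  [NonUnitalNormedRing A] [NormedSpace ℝ A] [IsScalarTower ℝ A A] [SMulCommClass ℝ A A]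
  [NormedAddCommGroup X] [NormedSpace ℝ X]
  {D : PreorderedDynamicalSystem G A} {hα : D.UniformlyBounded} {Xpos : PointedCone ℝ X}
  (T : PositiveBeurlingRep hα μ ω Xpos)

lemma dense_span_cc :
    Dense (Submodule.span ℝ {y : X | ∃ (f : C_c(G, A)) (x : X), y = T.T (toWeightedL1 μ ω f) x} :
      Set X) :=
  dense_span_of_toWeightedL1 T.nondegenerate

lemma map_twistedConv (f g : C_c(G, A)) (x : X) :
    T.T (toWeightedL1 μ ω (PreorderedDynamicalSystem.twistedConv hα μ f g)) x =
      T.T (toWeightedL1 μ ω f) (T.T (toWeightedL1 μ ω g) x) := by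
  rw [← PreorderedDynamicalSystem.beurlingMul_toWeightedL1, T.map_mul]

variable {T} in
/-- Operators which agree on the vectors `T(f)x` with `f` in `C_c(G, A)` are equal. -/
lemma operator_ext {S S' : X →L[ℝ] X} (h : ∀ (f : C_c(G, A)) (x : X),
    S (T.T (toWeightedL1 μ ω f) x) = S' (T.T (toWeightedL1 μ ω f) x)) : S = S' :=
  ContinuousLinearMap.ext_on T.dense_span_cc (by rintro _ ⟨f, x, rfl⟩; exact h f x)

variable [CompleteSpace A] [CompleteSpace X]

/-- The strong limits of the operators `T(z ⊗ b)` along an approximate point mass `z` at `s` and a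
bounded net `b` of left multipliers which converges strongly. -/
lemma exists_limit {κ : Type*} {l : Filter κ} [l.NeBot] {s : G} {z : κ → C_c(G, ℝ)}
    (hz : IsApproxDelta μ l s z) {S : ℝ} (hS0 : 0 ≤ S)
    (hS : ∀ q, ∀ r ∈ Function.support (z q), ω r ≤ S) {b : κ → A} {B : ℝ} (hb : ∀ q, ‖b q‖ ≤ B)
    {L : A →L[ℝ] A} (hL : ∀ a, Tendsto (fun q => b q * a) l (𝓝 (L a))) :
    ∃ S' : X →L[ℝ] X, ‖S'‖ ≤ ‖T.T‖ * (S * B) ∧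
      (∀ x, Tendsto (fun q => T.T (toWeightedL1 μ ω (ccTensor (z q) (b q))) x) l (𝓝 (S' x))) ∧
      ∀ (f : C_c(G, A)) (x : X), S' (T.T (toWeightedL1 μ ω f) x) =
        T.T (toWeightedL1 μ ω (ccMap L (ccShift D s f))) x := by
  -- Multiplicativity rewrites `T(z ⊗ b) T(f)x` as `T((z ⊗ b) * f)x`, where the limit of the
  -- convolutions is known.
  have hlim : ∀ (f : C_c(G, A)) (x : X), Tendsto
      (fun q => T.T (toWeightedL1 μ ω (ccTensor (z q) (b q))) (T.T (toWeightedL1 μ ω f) x)) l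
      (𝓝 (T.T (toWeightedL1 μ ω (ccMap L (ccShift D s f))) x)) := fun f x => by
    simp only [← map_twistedConv]
    exact ((by fun_prop : Continuous fun h => T.T h x).tendsto _).comp
      (hz.tendsto_twistedConv ω hα hb hL f)
  have hbd : ∀ q, ‖T.T (toWeightedL1 μ ω (ccTensor (z q) (b q)))‖ ≤ ‖T.T‖ * (S * B) := fun q =>
    (T.T.le_opNorm _).trans (mul_le_mul_of_nonneg_left
      ((norm_toWeightedL1_ccTensor_le ω (hz.nonneg q) (hz.integral_eq_one q) (hS q) _).trans
        (mul_le_mul_of_nonneg_left (hb q) hS0)) (norm_nonneg _))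
  obtain ⟨S', hS', ht⟩ := exists_strong_limit hbd T.dense_span_cc (by
    rintro _ ⟨f, x, rfl⟩; exact ⟨_, hlim f x⟩)
  exact ⟨S', hS', ht, fun f x => tendsto_nhds_unique (ht _) (hlim f x)⟩

/-- The operator of left multiplication with `a` on the representation space. -/
lemma exists_π {V K : Set G} (hV : V ∈ 𝓝 1) (hK : IsCompact K) (hVK : V ⊆ K) {S : ℝ}
    (hS : ∀ r ∈ V, ω r ≤ S) (hX : IsClosed (Xpos : Set X)) (a : A) :
    ∃ P : X →L[ℝ] X, ‖P‖ ≤ ‖T.T‖ * (S * ‖a‖) ∧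
      (∀ (f : C_c(G, A)) (x : X), P (T.T (toWeightedL1 μ ω f) x) =
        T.T (toWeightedL1 μ ω (ccMap (ContinuousLinearMap.mul ℝ A a) f)) x) ∧
      (a ∈ D.cone → ∀ x ∈ Xpos, P x ∈ Xpos) := by
  have h𝒵 := isCompactlyBoundedNhdsBase_of_subset_compact hV hK hVK
  choose z hz using fun W : {W : Set G | W ∈ 𝓝 1 ∧ W ⊆ V} =>
    exists_bump μ (h𝒵.hasBasis.mem_of_mem W.2)
  have := h𝒵.neBot_atTop Unit
  -- The multipliers are constantly `a`, with no approximate identity, so its bound does not enter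
  -- the estimate.
  obtain ⟨P, h1, h2, h3⟩ := T.exists_limit (h𝒵.isApproxDelta hz Unit)
    ((ω.nonneg' 1).trans (hS 1 (mem_of_mem_nhds hV)))
    (fun q r hr => hS r ((OrderDual.ofDual q.1).2.2 ((hz _).2.1 hr))) (b := fun _ => a)
    (fun _ => le_rfl) (L := ContinuousLinearMap.mul ℝ A a) fun _ => tendsto_const_nhds
  refine ⟨P, h1, fun f x => by rw [h3, ccShift_one], fun ha x hx =>
    hX.mem_of_tendsto (h2 x) (Eventually.of_forall fun q => T.positive _ ?_ x hx)⟩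
  exact ccTensor_mem_weightedL1Cone μ ω (hz _).1 ha

/-- The operator of translation by `s` on the representation space. -/
lemma exists_U {V K : Set G} (hV : V ∈ 𝓝 1) (hK : IsCompact K) (hVK : V ⊆ K) {S : ℝ}
    (hS : ∀ r ∈ V, ω r ≤ S) (hX : IsClosed (Xpos : Set X)) {M : ℝ} {C : Set A}
    (hM : HasApproxLeftIdentityIn M C) (s : G) :
    ∃ P : X →L[ℝ] X, ‖P‖ ≤ M * S * ‖T.T‖ * ω s ∧
      (∀ (f : C_c(G, A)) (x : X), P (T.T (toWeightedL1 μ ω f) x) =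
        T.T (toWeightedL1 μ ω (ccShift D s f)) x) ∧
      (C ⊆ D.cone → ∀ x ∈ Xpos, P x ∈ Xpos) := by
  -- The set `C` serves two purposes: the positive cone yields positivity, while the whole of `A`
  -- yields the norm bound with the constant of an arbitrary approximate left identity.
  obtain ⟨ι, _, _, _, u, hu, huC⟩ := hM
  have h𝒵 := isCompactlyBoundedNhdsBase_of_subset_compact hV hK hVK
  choose z hz using fun W : {W : Set G | W ∈ 𝓝 1 ∧ W ⊆ V} =>
    exists_bump μ (h𝒵.hasBasis.mem_of_mem W.2)
  have := h𝒵.neBot_atTop ι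
  have hS0 : 0 ≤ S := (ω.nonneg' 1).trans (hS 1 (mem_of_mem_nhds hV))
  have hlim : ∀ a, Tendsto (fun q : ({W : Set G | W ∈ 𝓝 1 ∧ W ⊆ V})ᵒᵈ × ι => u q.2 * a) atTop
      (𝓝 (ContinuousLinearMap.id ℝ A a)) := fun a => by
    rw [← prod_atTop_atTop_eq]
    exact (hu.tendsto a).comp tendsto_snd
  -- The translated bump lives on `sV`, where submultiplicativity bounds the weight by `ω s * S`.
  have hbd : ∀ q : ({W : Set G | W ∈ 𝓝 1 ∧ W ⊆ V})ᵒᵈ × ι,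
      ∀ r ∈ Function.support (ccTranslate s (z (OrderDual.ofDual q.1))), ω r ≤ ω s * S := by
    intro q r hr
    have h0 : s⁻¹ * r ∈ Function.support (z (OrderDual.ofDual q.1)) := hr
    have h1 := hS (s⁻¹ * r) ((OrderDual.ofDual q.1).2.2 ((hz (OrderDual.ofDual q.1)).2.1 h0))
    have h2 := ω.submul' s (s⁻¹ * r)
    rw [mul_inv_cancel_left] at h2
    exact h2.trans (mul_le_mul_of_nonneg_left h1 (ω.nonneg' s))
  obtain ⟨P, h1, h2, h3⟩ := T.exists_limit ((h𝒵.isApproxDelta hz ι).translate s)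
    (mul_nonneg (ω.nonneg' s) hS0)
    hbd (fun q => hu.bounded q.2) hlim
  refine ⟨P, h1.trans_eq (by ring), fun f x => by rw [h3, ccMap_id], fun hC x hx =>
    hX.mem_of_tendsto (h2 x) (Eventually.of_forall fun q => T.positive _ ?_ x hx)⟩
  exact ccTensor_mem_weightedL1Cone μ ω (fun r => (hz (OrderDual.ofDual q.1)).1 (s⁻¹ * r))
    (hC (huC q.2))

/-- A non-degenerate positive representation of the generalized Beurling algebra comes from a
covariant representation, which acts on the vectors `T(f)x` through left multiplication and
translation of `f`. -/
lemma exists_covariantRep (hX : IsClosed (Xpos : Set X))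
    (hleft : ∃ M : ℝ, HasApproxLeftIdentityIn M (D.cone : Set A)) :
    ∃ p : PositiveCovariantRep D ω Xpos,
      (∀ (a : A) (f : C_c(G, A)) (x : X), p.π a (T.T (toWeightedL1 μ ω f) x) =
        T.T (toWeightedL1 μ ω (ccMap (ContinuousLinearMap.mul ℝ A a) f)) x) ∧
      ∀ (s : G) (f : C_c(G, A)) (x : X), p.U s (T.T (toWeightedL1 μ ω f) x) =
        T.T (toWeightedL1 μ ω (ccShift D s f)) x := by
  obtain ⟨M, hM⟩ := hleft
  obtain ⟨K, hK, hK1⟩ := exists_compact_mem_nhds (1 : G)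
  obtain ⟨S, hS0, hS⟩ := ω.bounded_on_compact hK
  choose P hPn hP hPpos using T.exists_π hK1 hK subset_rfl hS hX
  choose V hVn hV hVpos using T.exists_U hK1 hK subset_rfl hS hX hM
  have hcont : ∀ x : X, Continuous fun h : WeightedL1 μ ω A => T.T h x := fun x => by fun_prop
  -- The algebraic identities for `π` and `U` are inherited, through `operator_ext`, from those of
  -- multiplication and translation on functions.
  let π : A →L[ℝ] X →L[ℝ] X := LinearMap.mkContinuous
    { toFun := P
      map_add' := fun a b => operator_ext (T := T) fun f x => by
        rw [_root_.add_apply, hP, hP, hP, ← _root_.add_apply, ← map_add]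
        congr 2
        rw [← toWeightedL1ₗ_apply, ← toWeightedL1ₗ_apply, ← toWeightedL1ₗ_apply, ← map_add]
        congr 1
        ext r
        simp
      map_smul' := fun c a => operator_ext (T := T) fun f x => by
        rw [RingHom.id_apply, _root_.smul_apply, hP, hP, ← _root_.smul_apply, ← map_smul]
        congr 2
        rw [← toWeightedL1ₗ_apply, ← toWeightedL1ₗ_apply, ← map_smul]
        congr 1
        ext r
        simp }
    (‖T.T‖ * S) fun a => (hPn a).trans_eq (mul_assoc _ _ _).symm
  have hπ : ∀ a, π a = P a := fun _ => rfl
  let V' : G →* (X →L[ℝ] X) :=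
    { toFun := V
      map_one' := operator_ext (T := T) fun f x => by
        rw [hV, ccShift_one]; rfl
      map_mul' := fun s t => operator_ext (T := T) fun f x => by
        rw [hV, ccShift_mul, ← hV, ← hV]; rfl }
  -- A monoid homomorphism from a group takes values in the units, so invertibility comes for free.
  let U : G →* (X ≃L[ℝ] X) :=
    (ContinuousLinearEquiv.unitsEquiv ℝ X).toMonoidHom.comp V'.toHomUnits
  have hU : ∀ s x, U s x = V s x := fun _ _ => rfl
  have hUs : ∀ s x, (U s).symm x = V s⁻¹ x := fun _ _ => rfl
  have hVV : ∀ s x, V s (V s⁻¹ x) = x := fun s x => by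
    rw [← hU, ← hUs, ContinuousLinearEquiv.apply_symm_apply]
  have hpos : ∀ s, ∀ x ∈ Xpos, V s x ∈ Xpos := fun s => hVpos s subset_rfl
  have hloc : ∀ s : G, ∃ N ∈ 𝓝 s, ∃ C, ∀ r ∈ N, ‖V r‖ ≤ C := fun s => by
    obtain ⟨C, hC⟩ := ω.locally_bounded s
    refine ⟨_, hC, |M * S * ‖T.T‖| * C, fun r hr => (hVn r).trans ?_⟩
    exact mul_le_mul (le_abs_self _) hr (ω.nonneg' r) (abs_nonneg _)
  have hM0 : 0 ≤ M := by
    obtain ⟨ι, _, _, ⟨i⟩, u, hu, -⟩ := hM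
    exact (norm_nonneg _).trans (hu.bounded i)
  refine ⟨⟨π, U, fun a b x => ?_, fun a s x => ?_, fun x => ?_, ?_, fun a ha => hPpos a ha,
    fun s x => ⟨fun h => ?_, hpos s x⟩, M * S * ‖T.T‖, by positivity, hVn⟩,
    fun a f x => hP a f x, fun s f x => hV s f x⟩
  · have : π (a * b) = (π a).comp (π b) := operator_ext (T := T) fun f x => by
      simp only [hπ, ContinuousLinearMap.comp_apply, hP]
      congr 3
      ext r
      simp [mul_assoc]
    rw [this]; rfl
  · have : π (D.α s a) = (V s).comp ((π a).comp (V s⁻¹)) := operator_ext (T := T) fun f x => by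
      simp only [hπ, ContinuousLinearMap.comp_apply, hP, hV]
      congr 3
      ext r
      have h1 : D.α s (D.α s⁻¹ (f r)) = f r := by
        rw [map_inv]; exact (D.α s).apply_symm_apply _
      simp [D.α_mul, h1, -map_inv]
    rw [this]; rfl
  · rw [continuous_iff_continuousAt]
    intro s
    obtain ⟨N, hN, C, hC⟩ := hloc s
    have hN' : ∀ᶠ r in 𝓝 s, r ∈ N := hN
    -- Strong continuity holds on the vectors `T(f)y` and extends by boundedness. A bound is
    -- available only near `s`, so the net is restricted to a neighbourhood `N`, which does not
    -- change the limit.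
    let S' : N → X →L[ℝ] X := fun r => V r
    have hne : (comap ((↑) : N → G) (𝓝 s)).NeBot := comap_coe_neBot_of_le_principal
      (l := 𝓝 s) (le_principal_iff.2 hN)
    have ht := tendsto_of_tendsto_on_dense (l := comap ((↑) : N → G) (𝓝 s)) (S := S')
      (fun q => hC q q.2) T.dense_span_cc (S' := V s) (by
        rintro _ ⟨f, y, rfl⟩
        simp only [S', hV]
        exact (((hcont y).comp (continuous_toWeightedL1_ccShift μ ω hα f)).tendsto s).comp
          tendsto_comap) x
    rw [ContinuousAt]
    simp only [hU]
    rw [← map_comap_of_mem (f := 𝓝 s) (m := ((↑) : N → G)) (by simpa using hN)]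
    exact tendsto_map'_iff.2 ht
  · obtain ⟨ι, _, _, _, u, hu, -⟩ := hM
    set W := Submodule.span ℝ {y : X | ∃ a x, y = π a x}
    have hle : Submodule.span ℝ {y : X | ∃ (f : C_c(G, A)) (x : X),
        y = T.T (toWeightedL1 μ ω f) x} ≤ W.topologicalClosure := by
      refine Submodule.span_le.2 ?_
      rintro _ ⟨f, x, rfl⟩
      -- Multipliers `u i` converge uniformly on the compact range of `f`, so `T(f)x` is the limit
      -- of the vectors `π(u i) T(f)x`.
      have h1 : Tendsto (fun i => toWeightedL1 μ ω (ccMap (ContinuousLinearMap.mul ℝ A (u i)) f))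
          atTop (𝓝 (toWeightedL1 μ ω f)) := by
        refine tendsto_toWeightedL1 μ ω f.hasCompactSupport
          (fun t ht => image_eq_zero_of_notMem_tsupport ht)
          (Eventually.of_forall fun i t ht => ?_) fun ε hε => ?_
        · rw [ccMap_apply, image_eq_zero_of_notMem_tsupport ht, map_zero]
        · filter_upwards [eventually_norm_mul_sub_le hu.bounded (L := ContinuousLinearMap.id ℝ A)
            hu.tendsto (f.hasCompactSupport.isCompact.image f.continuous) hε] with i hi t ht
          exact hi _ (mem_image_of_mem _ ht)
      refine W.isClosed_topologicalClosure.mem_of_tendsto (((hcont x).tendsto _).comp h1)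
        (Eventually.of_forall fun i => W.le_topologicalClosure (Submodule.subset_span
          ⟨u i, T.T (toWeightedL1 μ ω f) x, ?_⟩))
      rw [hπ, hP]; rfl
    exact Dense.of_closure (T.dense_span_cc.mono hle)
  · have h1 := hpos s⁻¹ _ h
    rwa [hU, ← inv_inv s, inv_inv s⁻¹, hVV] at h1

/-- The covariant representation determined by its action on the vectors `T(f)x` integrates to
`T`. -/
lemma integrated_eq {p : PositiveCovariantRep D ω Xpos}
    (hπ : ∀ (a : A) (f : C_c(G, A)) (x : X), p.π a (T.T (toWeightedL1 μ ω f) x) =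
      T.T (toWeightedL1 μ ω (ccMap (ContinuousLinearMap.mul ℝ A a) f)) x)
    (hU : ∀ (s : G) (f : C_c(G, A)) (x : X), p.U s (T.T (toWeightedL1 μ ω f) x) =
      T.T (toWeightedL1 μ ω (ccShift D s f)) x) : p.integrated μ = T.T := by
  refine ext_of_toWeightedL1 fun f => operator_ext (T := T) fun g x => ?_
  rw [p.integrated_toWeightedL1, ← map_twistedConv]
  simp only [hU, hπ]
  -- What remains is to move the integral of `r ↦ f(r) α_r(g(r⁻¹ ·))` inside `T`; its pointwise
  -- integral is by definition the twisted convolution.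
  refine integral_toWeightedL1 μ ω (T.T.flip x)
    (F := fun r => ccMap (ContinuousLinearMap.mul ℝ A (f r)) (ccShift D r g)) ?_
    (IsCompact.mul f.hasCompactSupport g.hasCompactSupport) f.hasCompactSupport ?_ ?_ ?_
  · exact (PreorderedDynamicalSystem.continuous_convIntegrand hα f g).comp continuous_swap
  · intro r t ht
    by_cases hr : r ∈ tsupport f
    · rw [ccMap_apply, ccShift_eq_zero_of_notMem g hr ht, map_zero]
    · simp [image_eq_zero_of_notMem_tsupport hr]
  · intro r hr
    ext t
    simp [image_eq_zero_of_notMem_tsupport hr]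
  · exact fun t => rfl

end PositiveBeurlingRep

/-! ### The bijection -/

namespace PositiveCovariantRep

variable {G A X : Type*} [Group G] [TopologicalSpace G] [IsTopologicalGroup G] [T2Space G]
  [LocallyCompactSpace G] [MeasurableSpace G] [BorelSpace G]
  {μ : Measure G} [μ.IsHaarMeasure] {ω : GroupWeight G}
  [NonUnitalNormedRing A] [NormedSpace ℝ A] [IsScalarTower ℝ A A] [SMulCommClass ℝ A A]
  [NormedAddCommGroup X] [NormedSpace ℝ X] [CompleteSpace X]
  {D : PreorderedDynamicalSystem G A} {hα : D.UniformlyBounded} {Xpos : PointedCone ℝ X}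

variable {p : PositiveCovariantRep D ω Xpos} {T : PositiveBeurlingRep hα μ ω Xpos}
  (hp : p.integrated μ = T.T)

include hp

lemma π_apply_of_integrated_eq (a : A) (f : C_c(G, A)) (x : X) :
    p.π a (T.T (toWeightedL1 μ ω f) x) =
      T.T (toWeightedL1 μ ω (ccMap (ContinuousLinearMap.mul ℝ A a) f)) x := by
  rw [← hp, p.π_integrated]

lemma U_apply_of_integrated_eq (s : G) (f : C_c(G, A)) (x : X) :
    p.U s (T.T (toWeightedL1 μ ω f) x) = T.T (toWeightedL1 μ ω (ccShift D s f)) x := by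
  rw [← hp, p.U_integrated]

lemma eq_of_integrated_eq {p' : PositiveCovariantRep D ω Xpos} (hp' : p'.integrated μ = T.T) :
    p = p' := by
  refine PositiveCovariantRep.ext (ContinuousLinearMap.ext fun a =>
    PositiveBeurlingRep.operator_ext (T := T) fun f x => ?_) (MonoidHom.ext fun s => ?_)
  · rw [π_apply_of_integrated_eq hp, π_apply_of_integrated_eq hp']
  · have : (p.U s : X →L[ℝ] X) = p'.U s :=
      PositiveBeurlingRep.operator_ext (T := T) fun f x =>
        (U_apply_of_integrated_eq hp s f x).trans (U_apply_of_integrated_eq hp' s f x).symm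
    exact ContinuousLinearEquiv.coe_injective this

variable [CompleteSpace A]

/-- `π(a)` is the strong limit of the operators `T(z ⊗ a u)`. -/
lemma tendsto_π {κ : Type*} {l : Filter κ} [l.NeBot] {z : κ → C_c(G, ℝ)}
    (hz : IsApproxDelta μ l 1 z) {u : κ → A} {M : ℝ} (hM : ∀ q, ‖u q‖ ≤ M)
    (hu : ∀ a, Tendsto (fun q => u q * a) l (𝓝 a)) (a : A) (x : X) :
    Tendsto (fun q => T.T (toWeightedL1 μ ω (ccTensor (z q) (a * u q))) x) l (𝓝 (p.π a x)) := by
  obtain ⟨K, hK, hzK⟩ := hz.exists_compact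
  obtain ⟨S, hS0, hS⟩ := ω.bounded_on_compact hK
  -- The products `a * u q` are left multipliers converging strongly to multiplication by `a`, so
  -- their limit operator agrees with `π(a)` on a set with dense span.
  obtain ⟨P, -, h2, h3⟩ := T.exists_limit hz hS0 (fun q r hr => hS r (hzK q hr))
    (b := fun q => a * u q) (B := ‖a‖ * M)
    (fun q => (norm_mul_le _ _).trans (mul_le_mul_of_nonneg_left (hM q) (norm_nonneg a)))
    (L := ContinuousLinearMap.mul ℝ A a) fun c => by
      simp only [mul_assoc]
      exact (hu c).const_mul a
  have : P = p.π a := PositiveBeurlingRep.operator_ext (T := T) fun f x => by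
    rw [h3, ccShift_one, π_apply_of_integrated_eq hp]
  exact this ▸ h2 x

/-- `U_s` is the strong limit of the operators `T(z(s⁻¹ ·) ⊗ u)`. -/
lemma tendsto_U {κ : Type*} {l : Filter κ} [l.NeBot] {z : κ → C_c(G, ℝ)}
    (hz : IsApproxDelta μ l 1 z) {u : κ → A} {M : ℝ} (hM : ∀ q, ‖u q‖ ≤ M)
    (hu : ∀ a, Tendsto (fun q => u q * a) l (𝓝 a)) (s : G) (x : X) :
    Tendsto (fun q => T.T (toWeightedL1 μ ω (ccTensor (ccTranslate s (z q)) (u q))) x) l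
      (𝓝 (p.U s x)) := by
  have hzs := hz.translate s
  obtain ⟨K, hK, hzK⟩ := hzs.exists_compact
  obtain ⟨S, hS0, hS⟩ := ω.bounded_on_compact hK
  obtain ⟨P, -, h2, h3⟩ := T.exists_limit hzs hS0 (fun q r hr => hS r (hzK q hr)) hM
    (L := ContinuousLinearMap.id ℝ A) hu
  have : P = p.U s := PositiveBeurlingRep.operator_ext (T := T) fun f x => by
    rw [h3, ccMap_id]
    exact (U_apply_of_integrated_eq hp s f x).symm
  subst this
  exact h2 x

variable {V K : Set G} (hV : V ∈ 𝓝 (1 : G)) (hK : IsCompact K) (hVK : V ⊆ K)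
  (hX : IsClosed (Xpos : Set X))

include hV hK hVK hX

/-- The operator from `exists_π`, built from functions supported in `V`, must be `π(a)`. Hence the
bound holds for each `V` separately, and the infimum can be taken afterwards. -/
lemma norm_π_le {S : ℝ} (hS : ∀ r ∈ V, ω r ≤ S) : ‖p.π‖ ≤ ‖T.T‖ * S := by
  refine p.π.opNorm_le_bound
    (mul_nonneg (norm_nonneg T.T) ((ω.nonneg' 1).trans (hS 1 (mem_of_mem_nhds hV)))) fun a => ?_
  obtain ⟨P, h1, h2, -⟩ := T.exists_π hV hK hVK hS hX a
  have : P = p.π a := PositiveBeurlingRep.operator_ext (T := T) fun f x => by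
    rw [h2, π_apply_of_integrated_eq hp]
  rw [mul_assoc]
  exact this ▸ h1

lemma norm_U_le {S : ℝ} (hS : ∀ r ∈ V, ω r ≤ S) {M : ℝ} {C : Set A}
    (hM : HasApproxLeftIdentityIn M C) (s : G) :
    ‖(p.U s : X →L[ℝ] X)‖ ≤ M * S * ‖T.T‖ * ω s := by
  obtain ⟨P, h1, h2, -⟩ := T.exists_U hV hK hVK hS hX hM s
  have : P = p.U s := PositiveBeurlingRep.operator_ext (T := T) fun f x => by
    rw [h2]
    exact (U_apply_of_integrated_eq hp s f x).symm
  exact this ▸ h1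

end PositiveCovariantRep

end

theorem theorem5p10 {G A X : Type*}
    [Group G] [TopologicalSpace G] [IsTopologicalGroup G] [LocallyCompactSpace G] [T2Space G]
    [MeasurableSpace G] [BorelSpace G] (μ : Measure G) [μ.IsHaarMeasure] [μ.Regular]
    [NonUnitalNormedRing A] [NormedSpace ℝ A] [IsScalarTower ℝ A A] [SMulCommClass ℝ A A]
    [CompleteSpace A]
    (D : PreorderedDynamicalSystem G A) (hα : D.UniformlyBounded) (ω : GroupWeight G)
    (hright : ∃ M : ℝ, HasApproxRightIdentity A M)
    (hleft : ∃ M : ℝ, HasApproxLeftIdentityIn M (D.cone : Set A))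
    [NormedAddCommGroup X] [NormedSpace ℝ X] [CompleteSpace X]
    (Xpos : PointedCone ℝ X) (hX : IsClosed (Xpos : Set X)) :
    ∃ Φ : PositiveCovariantRep D ω Xpos ≃ PositiveBeurlingRep hα μ ω Xpos,
      -- the map `(π, U) ↦ T^(π,U)`
      (∀ (p : PositiveCovariantRep D ω Xpos) (f : C_c(G, A)) (x : X),
        (Φ p).T (toWeightedL1 μ ω f) x = ∫ r, p.π (f r) (p.U r x) ∂μ) ∧
      -- the inverse map `T ↦ (π^T, U^T)`
      (∀ 𝒵 : Set (Set G), IsCompactlyBoundedNhdsBase 𝒵 →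
        ∀ z : 𝒵 → C_c(G, ℝ),
          (∀ V : 𝒵, (∀ r, 0 ≤ z V r) ∧ Function.support (z V) ⊆ V ∧ ∫ r, z V r ∂μ = 1) →
        ∀ (ι : Type*) [Preorder ι] [IsDirectedOrder ι] [Nonempty ι] (u : ι → A) (M : ℝ),
          IsApproxLeftIdentity M u → (∀ i, u i ∈ D.cone) →
        ∀ T : PositiveBeurlingRep hα μ ω Xpos,
          (∀ (a : A) (x : X), Tendsto
            (fun q : (𝒵)ᵒᵈ × ι =>
              T.T (toWeightedL1 μ ω (ccTensor (z (OrderDual.ofDual q.1)) (a * u q.2))) x)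
            atTop (𝓝 ((Φ.symm T).π a x))) ∧
          (∀ (s : G) (x : X), Tendsto
            (fun q : (𝒵)ᵒᵈ × ι =>
              T.T (toWeightedL1 μ ω
                (ccTensor (ccTranslate s (z (OrderDual.ofDual q.1))) (u q.2))) x)
            atTop (𝓝 ((Φ.symm T).U s x)))) ∧
      -- the norm bounds
      (∀ M : ℝ, HasApproxLeftIdentityIn M (Set.univ : Set A) →
        (∀ (p : PositiveCovariantRep D ω Xpos) (C : ℝ), 0 ≤ C →
          (∀ r, ‖(p.U r : X →L[ℝ] X)‖ ≤ C * ω r) → ‖(Φ p).T‖ ≤ C * ‖p.π‖) ∧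
        (∀ 𝒵 : Set (Set G), IsCompactlyBoundedNhdsBase 𝒵 →
          ∀ T : PositiveBeurlingRep hα μ ω Xpos,
            ‖(Φ.symm T).π‖ ≤ (⨅ V : 𝒵, ⨆ r : (V : Set G), ω r) * ‖T.T‖ ∧
            ∀ s : G, ‖((Φ.symm T).U s : X →L[ℝ] X)‖ ≤
              M * (⨅ V : 𝒵, ⨆ r : (V : Set G), ω r) * ‖T.T‖ * ω s)) := by
  let F : PositiveCovariantRep D ω Xpos → PositiveBeurlingRep hα μ ω Xpos :=
    fun p => p.integratedForm μ hα hX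
  have hinj : Function.Injective F := fun p p' h =>
    PositiveCovariantRep.eq_of_integrated_eq (T := F p') (congrArg PositiveBeurlingRep.T h) rfl
  have hsurj : Function.Surjective F := fun T => by
    obtain ⟨p, h1, h2⟩ := T.exists_covariantRep hX hleft
    exact ⟨p, PositiveBeurlingRep.ext (T.integrated_eq h1 h2)⟩
  let Φ := Equiv.ofBijective F ⟨hinj, hsurj⟩
  have hΦ : ∀ T, (Φ.symm T).integrated μ = T.T := fun T =>
    congrArg PositiveBeurlingRep.T (Φ.apply_symm_apply T)
  refine ⟨Φ, fun p f x => p.integrated_toWeightedL1 μ f x, ?_, fun M hM =>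
    ⟨fun p C hC0 hC => p.norm_integrated_le μ hC0 hC, fun 𝒵 h𝒵 T => ?_⟩⟩
  · intro 𝒵 h𝒵 z hz ι _ _ _ u M hu hpos T
    have hδ := h𝒵.isApproxDelta hz ι
    have := h𝒵.neBot_atTop ι
    have hu' : ∀ a, Tendsto (fun q : (𝒵)ᵒᵈ × ι => u q.2 * a) atTop (𝓝 a) := fun a => by
      rw [← prod_atTop_atTop_eq]
      exact (hu.tendsto a).comp tendsto_snd
    exact ⟨PositiveCovariantRep.tendsto_π (hΦ T) hδ (fun q => hu.bounded q.2) hu',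
      PositiveCovariantRep.tendsto_U (hΦ T) hδ (fun q => hu.bounded q.2) hu'⟩
  · obtain ⟨K, hK, hK𝒵⟩ := h𝒵.exists_compact
    have := h𝒵.nonempty
    obtain ⟨B, -, hB⟩ := ω.bounded_on_compact hK
    -- Members of the base lie in the compact `K`, so the weight is bounded on them and the real
    -- supremum is a genuine one.
    have hS : ∀ V : 𝒵, ∀ r ∈ (V : Set G), ω r ≤ ⨆ r : (V : Set G), ω r := fun V r hr =>
      le_ciSup (f := fun r : (V : Set G) => ω r)
        ⟨B, by rintro _ ⟨t, rfl⟩; exact hB t (hK𝒵 V V.2 t.2)⟩ ⟨r, hr⟩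
    have hT : 0 ≤ ‖T.T‖ := norm_nonneg T.T
    refine ⟨?_, fun s => ?_⟩
    · rw [Real.iInf_mul_of_nonneg hT]
      refine le_ciInf fun V => ?_
      rw [mul_comm]
      exact PositiveCovariantRep.norm_π_le (hΦ T) (h𝒵.hasBasis.mem_of_mem V.2) hK (hK𝒵 V V.2) hX
        (hS V)
    · have hM0 : 0 ≤ M := by
        obtain ⟨ι, _, _, ⟨i⟩, u, hu, -⟩ := hM
        exact (norm_nonneg _).trans (hu.bounded i)
      rw [Real.mul_iInf_of_nonneg hM0, Real.iInf_mul_of_nonneg hT,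
        Real.iInf_mul_of_nonneg (ω.nonneg' s)]
      exact le_ciInf fun V => PositiveCovariantRep.norm_U_le (hΦ T)
        (h𝒵.hasBasis.mem_of_mem V.2) hK (hK𝒵 V V.2) hX (hS V) hM s
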